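/- Let $\varphi=\frac{1+\sqrt5}{2}$. The two Robinson triangles are the following isosceles triangles with arrows on their sides. The half-kite is a triangle $abc$ with $|ab|=|ac|=\varphi$, $|bc|=1$, with a single arrow from $b$ to $a$ and double arrows from $a$ to $c$ and from $c$ to $b$. The half-dart is a triangle $abc$ with $|ab|=|ac|=1$, $|bc|=\varphi$, with a single arrow from $a$ to $b$ and double arrows from $a$ to $c$ and from $c$ to $b$. A Penrose tiling is an edge-to-edge tiling of the plane by images of these two decorated triangles under isometries of the plane (translations, rotations and reflections; the arrows are moved along with the triangle) such that, whenever two tiles share a side, both have on it the same arrow (single or double) pointing in the same direction. Here a tiling of the plane is a family of tiles with pairwise disjoint interiors whose union is the plane; it is edge-to-edge if any two distinct tiles are disjoint, or meet exactly in a common vertex, or meet exactly in a common side. Theorem. The Robinson triangles form an aperiodic protoset: there exist Penrose tilings of the plane (in which both triangles occur), and no Penrose tiling is periodic, that is, for no vector $v\neq 0$ does the translation by $v$ map the family of tiles (regarded as subsets of the plane) onto itself. -/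

import Mathlib

/-! Tilings of the Euclidean plane, with `ℂ` as the model of the plane, and the two
Robinson triangles with their arrows. -/

/-- A family of tiles (closed sets with nonempty interior) with pairwise disjoint interiors
whose union is the whole plane. -/
def IsPlaneTiling {ι : Type} (t : ι → Set ℂ) : Prop :=
  (∀ i, IsClosed (t i) ∧ (interior (t i)).Nonempty) ∧
    (∀ i j, i ≠ j → interior (t i) ∩ interior (t j) = ∅) ∧
    (⋃ i, t i) = Set.univ

/-- Some nonzero translation maps the family of tiles onto itself. Only the tiles as subsets of
the plane are considered. -/
def IsPeriodicFamily {ι : Type} (t : ι → Set ℂ) : Prop :=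
  ∃ v : ℂ, v ≠ 0 ∧ Set.range (fun i => (fun z => z + v) '' t i) = Set.range t

/-- The two prototiles: the acute golden triangle (half-kite) and the obtuse golden triangle
(half-dart). -/
inductive RobinsonKind where
  | halfKite
  | halfDart

/-- Length of the two equal sides. -/
noncomputable def RobinsonKind.leg : RobinsonKind → ℝ
  | .halfKite => Real.goldenRatio
  | .halfDart => 1

/-- Length of the base. -/
noncomputable def RobinsonKind.base : RobinsonKind → ℝ
  | .halfKite => 1
  | .halfDart => Real.goldenRatio

/-- The arrow drawn on a side is single or double. -/
inductive ArrowKind where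
  | single
  | double

/-- A side of a tile with its arrow, which points from `tail` to `head`. -/
structure ArrowedSide where
  tail : ℂ
  head : ℂ
  kind : ArrowKind

/-- The underlying segment. -/
def ArrowedSide.seg (e : ArrowedSide) : Set ℂ := segment ℝ e.tail e.head

/-- A placed copy of one of the two prototiles. The vertex `a` is the apex, `ab` is the leg with
the single arrow, and the sides `ac` and `cb` carry the double arrows. Since the side lengths fix
the triple `(a, b, c)` up to an isometry of the plane, these are exactly the images of the
decorated prototiles under isometries (translations, rotations, reflections). -/
structure RobinsonTriangle where
  kind : RobinsonKind
  a : ℂ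
  b : ℂ
  c : ℂ
  dist_ab : dist a b = kind.leg
  dist_ac : dist a c = kind.leg
  dist_bc : dist b c = kind.base

namespace RobinsonTriangle

def vertices (t : RobinsonTriangle) : Set ℂ := {t.a, t.b, t.c}

/-- The tile as a subset of the plane. -/
def region (t : RobinsonTriangle) : Set ℂ := convexHull ℝ t.vertices

/-- The side with the single arrow: towards the apex in a half-kite, away from it in a
half-dart. -/
def singleSide (t : RobinsonTriangle) : ArrowedSide :=
  match t.kind with
  | .halfKite => ⟨t.b, t.a, .single⟩
  | .halfDart => ⟨t.a, t.b, .single⟩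

/-- The three sides; the double arrows run from `a` to `c` and from `c` to `b`. -/
def sides (t : RobinsonTriangle) : Set ArrowedSide :=
  {t.singleSide, ⟨t.a, t.c, .double⟩, ⟨t.c, t.b, .double⟩}

end RobinsonTriangle

/-- An edge-to-edge tiling of the plane by copies of the Robinson triangles in which any two tiles
with a common side have the same arrow (kind and direction) on it. -/
structure IsPenroseTiling (T : Set RobinsonTriangle) : Prop where
  tiling : IsPlaneTiling (fun t : T => t.1.region)
  edge_to_edge : ∀ s ∈ T, ∀ t ∈ T, s ≠ t →
    s.region ∩ t.region = ∅ ∨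
    (∃ p ∈ s.vertices ∩ t.vertices, s.region ∩ t.region = {p}) ∨
    (∃ e ∈ s.sides, ∃ f ∈ t.sides, e.seg = f.seg ∧ s.region ∩ t.region = e.seg)
  arrows_match : ∀ s ∈ T, ∀ t ∈ T, s ≠ t → ∀ e ∈ s.sides, ∀ f ∈ t.sides, e.seg = f.seg → e = f

/-! A tile is stored as a kind and a frame: a point with two unit vectors at 36°. A `TileSystem` is
a set of such tiles with disjoint interiors in which every side has a matching neighbour. All
possible neighbours are explicit affine expressions in the frame, so the combinatorics becomes
algebra over τ² = τ + 1.

Aperiodicity. In a tile system the tiles group in only one way into larger Robinson triangles,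
bigger by the factor τ. Angle counts at vertices force a half-kite across the short double leg of
every half-dart (`TileSystem.kite_ka`). What lies across the base of a half-dart then decides its
group: another half-dart gives a large half-kite, a half-kite gives a large half-dart. Every
half-kite fits into such a group (`TileSystem.dart_ka_or`), and the large triangles, scaled down,
again form a tile system (`TileSystem.compose`). Since the grouping is canonical, a period v of the
tiles becomes a period v/τ of the composed system. Iteration yields arbitrarily short periods, but
each tile contains a disc of radius 0.04 and so overlaps its translate by a shorter vector; hence v
= 0.

The periods in the theorem concern the tiles as sets, without arrows. A translation might exchange
the ends of the base of a half-dart; `IsPenroseTiling.dart_shift` rules this out, and half-darts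
alone determine the composed system (`IsPenroseTiling.hasPeriod_compose`).

Existence. Dilating by τ and dissecting preserves disjointness and neighbours (`Packing.inflate`,
`HasMates.inflate`). A suitable half-kite reappears, with all its neighbours, in its fourth
inflation (`continues_single_seed`), so repeated inflation gives an increasing sequence of patches
whose union is a tile system. A nonempty tile system covers the plane (`TileSystem.iUnion_region`):
off the countable set of vertices every covered point is interior to the closed union, and the
complement of that set is connected and dense. -/

/-- The golden ratio. -/
noncomputable def tau : ℝ := Real.goldenRatio

theorem tau_sq : tau ^ 2 = tau + 1 := Real.goldenRatio_sq

theorem tau_pos : 0 < tau := Real.goldenRatio_pos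

theorem tau_gt : 1.618 < tau := by nlinarith [tau_sq, tau_pos]

theorem tau_lt : tau < 1.6181 := by nlinarith [tau_sq, tau_pos]

theorem ofReal_tau_sq : (tau : ℂ) ^ 2 = tau + 1 := by exact_mod_cast tau_sq

theorem RobinsonKind.leg_pos (k : RobinsonKind) : 0 < k.leg := by
  cases k
  · exact tau_pos
  · exact one_pos

theorem leg_halfKite : RobinsonKind.leg .halfKite = tau := rfl

theorem leg_halfDart : RobinsonKind.leg .halfDart = 1 := rfl

/-! ### Frames, their moves and their coordinates -/

/-- An origin together with two vectors, meant to be unit vectors at an angle of 36 degrees. -/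
@[ext] structure Frame where
  o : ℂ
  e : ℂ
  f : ℂ

namespace Frame

/-- The two vectors of the frame are unit vectors at an angle of 36 degrees. -/
def Valid (F : Frame) : Prop :=
  F.e.re ^ 2 + F.e.im ^ 2 = 1 ∧ F.f.re ^ 2 + F.f.im ^ 2 = 1 ∧
    F.e.re * F.f.re + F.e.im * F.f.im = tau / 2

/-- Reflection of the frame in its first axis. -/
@[simps] noncomputable def mE (F : Frame) : Frame := ⟨F.o, F.e, tau * F.e - F.f⟩

/-- Reflection of the frame in its second axis. -/
@[simps] noncomputable def mF (F : Frame) : Frame := ⟨F.o, tau * F.f - F.e, F.f⟩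

/-- The frame of the half-kite next to the short double side of a half-dart, and conversely. -/
@[simps] noncomputable def ka (F : Frame) : Frame := ⟨F.o + tau ^ 2 * F.f, F.e - tau * F.f, -F.f⟩

/-- The frame of the half-dart next to the long double side of a half-kite. -/
@[simps] noncomputable def eta (F : Frame) : Frame := ⟨F.o + tau * F.f, -F.f, -F.e⟩

/-- The frame of the half-kite next to the long double side of a half-dart. -/
@[simps] noncomputable def etaInv (F : Frame) : Frame := ⟨F.o + tau * F.e, -F.f, -F.e⟩

/-- The frame of the mirror image of a half-kite in its base. -/
@[simps] noncomputable def be (F : Frame) : Frame := ⟨F.o + tau * F.e + tau * F.f, -F.f, -F.e⟩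

/-- The frame of the mirror image of a half-dart in its short double side. -/
@[simps] noncomputable def de (F : Frame) : Frame :=
  ⟨F.o - F.e + tau ^ 2 * F.f, tau * F.e - tau * F.f, F.e - tau * F.f⟩

/-- The frame dilated by the golden ratio, with its vectors kept. -/
@[simps] noncomputable def sc (F : Frame) : Frame := ⟨tau * F.o, F.e, F.f⟩

/-- The frame of the half-dart contained in a dissected half-dart. -/
@[simps] noncomputable def nu (F : Frame) : Frame :=
  ⟨F.o + tau ^ 2 * F.e, F.f - tau * F.e, -F.e⟩

/-- The frame of a half-dart with the two ends of its base exchanged. -/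
@[simps] noncomputable def flip (F : Frame) : Frame :=
  ⟨F.o + tau * F.e, -F.e, F.f - tau * F.e⟩

/-- The translated frame. -/
@[simps] def shift (F : Frame) (v : ℂ) : Frame := ⟨F.o + v, F.e, F.f⟩

variable {F : Frame}

theorem Valid.mE (h : F.Valid) : F.mE.Valid := by
  have := tau_sq
  obtain ⟨h1, h2, h3⟩ := h
  refine ⟨?_, ?_, ?_⟩ <;> simp <;> grind

theorem Valid.mF (h : F.Valid) : F.mF.Valid := by
  have := tau_sq
  obtain ⟨h1, h2, h3⟩ := h
  refine ⟨?_, ?_, ?_⟩ <;> simp <;> grind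

theorem Valid.ka (h : F.Valid) : F.ka.Valid := by
  have := tau_sq
  obtain ⟨h1, h2, h3⟩ := h
  refine ⟨?_, ?_, ?_⟩ <;> simp <;> grind

theorem Valid.eta (h : F.Valid) : F.eta.Valid := by
  obtain ⟨h1, h2, h3⟩ := h
  refine ⟨?_, ?_, ?_⟩ <;> simp <;> grind

theorem Valid.etaInv (h : F.Valid) : F.etaInv.Valid := by
  obtain ⟨h1, h2, h3⟩ := h
  refine ⟨?_, ?_, ?_⟩ <;> simp <;> grind

theorem Valid.be (h : F.Valid) : F.be.Valid := by
  obtain ⟨h1, h2, h3⟩ := h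
  refine ⟨?_, ?_, ?_⟩ <;> simp <;> grind

theorem Valid.nu (h : F.Valid) : F.nu.Valid := by
  have := tau_sq
  obtain ⟨h1, h2, h3⟩ := h
  refine ⟨?_, ?_, ?_⟩ <;> simp <;> grind

theorem valid_sc : F.sc.Valid ↔ F.Valid := Iff.rfl

theorem ka_ka (F : Frame) : F.ka.ka = F := by
  have := ofReal_tau_sq
  ext <;> simp

theorem mE_mE (F : Frame) : F.mE.mE = F := by
  ext <;> simp

theorem ka_injective : Function.Injective ka :=
  Function.LeftInverse.injective ka_ka

theorem mE_injective : Function.Injective mE :=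
  Function.LeftInverse.injective mE_mE

theorem sc_injective : Function.Injective sc := by
  intro F G h
  have ht : (tau : ℂ) ≠ 0 := by exact_mod_cast tau_pos.ne'
  simp only [Frame.ext_iff, sc_o, sc_e, sc_f, mul_right_inj' ht] at h
  exact Frame.ext h.1 h.2.1 h.2.2

theorem nu_injective : Function.Injective nu := by
  intro F G h
  simp only [Frame.ext_iff, nu_o, nu_e, nu_f, neg_inj] at h
  obtain ⟨h1, h2, h3⟩ := h
  ext
  · simpa [h3] using h1
  · exact h3
  · simpa [h3] using h2

/-- The point with given coordinates with respect to the frame. -/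
noncomputable def pt (F : Frame) (x y : ℝ) : ℂ := F.o + x * F.e + y * F.f

noncomputable def det (F : Frame) : ℝ := F.e.re * F.f.im - F.e.im * F.f.re

/-- The first coordinate with respect to the frame. -/
noncomputable def cx (F : Frame) (z : ℂ) : ℝ :=
  ((z - F.o).re * F.f.im - (z - F.o).im * F.f.re) / F.det

/-- The second coordinate with respect to the frame. -/
noncomputable def cy (F : Frame) (z : ℂ) : ℝ :=
  (F.e.re * (z - F.o).im - F.e.im * (z - F.o).re) / F.det

/-- Lagrange's identity gives det² = 1 − (τ/2)², which is positive because τ < 2. -/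
theorem Valid.det_ne (h : F.Valid) : F.det ≠ 0 := by
  obtain ⟨h1, h2, h3⟩ := h
  intro h0
  have h4 : F.det ^ 2 = 1 - (tau / 2) ^ 2 := by
    rw [det, ← h3]
    linear_combination (F.f.re ^ 2 + F.f.im ^ 2) * h1 + h2
  rw [h0] at h4
  nlinarith [tau_sq, tau_lt]

theorem cx_pt (hd : F.det ≠ 0) (x y : ℝ) : F.cx (F.pt x y) = x := by
  rw [cx, div_eq_iff hd]
  simp [pt, det]
  ring

theorem cy_pt (hd : F.det ≠ 0) (x y : ℝ) : F.cy (F.pt x y) = y := by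
  rw [cy, div_eq_iff hd]
  simp [pt, det]
  ring

theorem pt_cx_cy (h0 : F.det ≠ 0) (z : ℂ) : F.pt (F.cx z) (F.cy z) = z := by
  have h1 : F.cx z * F.det = (z - F.o).re * F.f.im - (z - F.o).im * F.f.re :=
    div_mul_cancel₀ _ h0
  have h2 : F.cy z * F.det = F.e.re * (z - F.o).im - F.e.im * (z - F.o).re :=
    div_mul_cancel₀ _ h0
  have hd : F.det = F.e.re * F.f.im - F.e.im * F.f.re := rfl
  simp only [Complex.sub_re, Complex.sub_im] at h1 h2
  apply Complex.ext
  · apply mul_right_cancel₀ h0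
    have : (F.pt (F.cx z) (F.cy z)).re = F.o.re + F.cx z * F.e.re + F.cy z * F.f.re := by
      simp [pt]
    rw [this]
    linear_combination F.e.re * h1 + F.f.re * h2 + (F.o.re - z.re) * hd
  · apply mul_right_cancel₀ h0
    have : (F.pt (F.cx z) (F.cy z)).im = F.o.im + F.cx z * F.e.im + F.cy z * F.f.im := by
      simp [pt]
    rw [this]
    linear_combination F.e.im * h1 + F.f.im * h2 + (F.o.im - z.im) * hd

theorem Valid.cx_pt (h : F.Valid) (x y : ℝ) : F.cx (F.pt x y) = x :=
  Frame.cx_pt h.det_ne x y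

theorem Valid.cy_pt (h : F.Valid) (x y : ℝ) : F.cy (F.pt x y) = y :=
  Frame.cy_pt h.det_ne x y

theorem Valid.pt_cx_cy (h : F.Valid) (z : ℂ) : F.pt (F.cx z) (F.cy z) = z :=
  Frame.pt_cx_cy h.det_ne z

theorem pt_inj (h : F.det ≠ 0) {x y x' y' : ℝ} (hp : F.pt x y = F.pt x' y') :
    x = x' ∧ y = y' :=
  ⟨by rw [← Frame.cx_pt h x y, hp, Frame.cx_pt h], by rw [← Frame.cy_pt h x y, hp, Frame.cy_pt h]⟩

theorem Valid.pt_inj (h : F.Valid) {x y x' y' : ℝ} (hp : F.pt x y = F.pt x' y') :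
    x = x' ∧ y = y' :=
  ⟨by rw [← h.cx_pt x y, hp, h.cx_pt], by rw [← h.cy_pt x y, hp, h.cy_pt]⟩

theorem continuous_cx (F : Frame) : Continuous F.cx := by
  unfold cx
  fun_prop

theorem continuous_cy (F : Frame) : Continuous F.cy := by
  unfold cy
  fun_prop

/-! ### Closed tiles and their interiors -/

/-- The tile of the given kind placed at a frame, as a closed set. -/
def region (k : RobinsonKind) (F : Frame) : Set ℂ :=
  {z | ∃ x y : ℝ, 0 ≤ x ∧ 0 ≤ y ∧ k.leg * x + tau * y ≤ tau * k.leg ∧ z = F.pt x y}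

/-- The interior of the tile of the given kind placed at a frame. -/
def cell (k : RobinsonKind) (F : Frame) : Set ℂ :=
  {z | ∃ x y : ℝ, 0 < x ∧ 0 < y ∧ k.leg * x + tau * y < tau * k.leg ∧ z = F.pt x y}

variable {k l : RobinsonKind}

theorem cell_subset_region : cell k F ⊆ region k F := by
  rintro z ⟨x, y, hx, hy, h, rfl⟩
  exact ⟨x, y, hx.le, hy.le, h.le, rfl⟩

theorem Valid.region_eq (h : F.Valid) : region k F =
    {z | 0 ≤ F.cx z ∧ 0 ≤ F.cy z ∧ k.leg * F.cx z + tau * F.cy z ≤ tau * k.leg} := by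
  ext z
  constructor
  · rintro ⟨x, y, hx, hy, hxy, rfl⟩
    simpa [h.cx_pt, h.cy_pt] using ⟨hx, hy, hxy⟩
  · rintro ⟨hx, hy, hxy⟩
    exact ⟨_, _, hx, hy, hxy, (h.pt_cx_cy z).symm⟩

theorem Valid.cell_eq (h : F.Valid) : cell k F =
    {z | 0 < F.cx z ∧ 0 < F.cy z ∧ k.leg * F.cx z + tau * F.cy z < tau * k.leg} := by
  ext z
  constructor
  · rintro ⟨x, y, hx, hy, hxy, rfl⟩
    simpa [h.cx_pt, h.cy_pt] using ⟨hx, hy, hxy⟩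
  · rintro ⟨hx, hy, hxy⟩
    exact ⟨_, _, hx, hy, hxy, (h.pt_cx_cy z).symm⟩

theorem Valid.isClosed_region (h : F.Valid) : IsClosed (region k F) := by
  have h1 := F.continuous_cx
  have h2 := F.continuous_cy
  rw [h.region_eq]
  exact (isClosed_le continuous_const h1).inter ((isClosed_le continuous_const h2).inter
    (isClosed_le ((h1.const_mul _).add (h2.const_mul _)) continuous_const))

theorem Valid.isOpen_cell (h : F.Valid) : IsOpen (cell k F) := by
  have h1 := F.continuous_cx
  have h2 := F.continuous_cy
  rw [h.cell_eq]
  exact (isOpen_lt continuous_const h1).inter ((isOpen_lt continuous_const h2).inter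
    (isOpen_lt ((h1.const_mul _).add (h2.const_mul _)) continuous_const))

/-- The centroid of a tile. -/
noncomputable def centroid (k : RobinsonKind) (F : Frame) : ℂ := F.pt (tau / 3) (k.leg / 3)

theorem centroid_mem_cell : centroid k F ∈ cell k F :=
  ⟨_, _, by linarith [tau_pos], by linarith [k.leg_pos], by nlinarith [mul_pos tau_pos k.leg_pos],
    rfl⟩

theorem pt_add_smul (F : Frame) (t x y a b : ℝ) :
    F.pt x y + t * (F.pt a b - F.pt x y) = F.pt (x + t * (a - x)) (y + t * (b - y)) := by
  simp [pt]
  ring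

/-- An open set that meets a tile meets its interior. -/
theorem inter_cell_nonempty {W : Set ℂ} (hW : IsOpen W) (h : (W ∩ region k F).Nonempty) :
    (W ∩ cell k F).Nonempty := by
  obtain ⟨z, hz, x, y, hx, hy, hxy, rfl⟩ := h
  -- By convexity, a point of the tile moved slightly towards the centroid lies in the interior.
  have hc : Filter.Tendsto (fun t : ℝ => F.pt x y + t * (centroid k F - F.pt x y))
      (nhdsWithin 0 (Set.Ioi 0)) (nhds (F.pt x y)) := by
    have : Continuous (fun t : ℝ => F.pt x y + t * (centroid k F - F.pt x y)) := by fun_prop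
    have := this.tendsto 0
    simp only [Complex.ofReal_zero, zero_mul, add_zero] at this
    exact this.mono_left nhdsWithin_le_nhds
  have h1 := hc.eventually (hW.mem_nhds hz)
  have h2 : ∀ᶠ t : ℝ in nhdsWithin 0 (Set.Ioi 0), t ∈ Set.Ioo (0 : ℝ) 1 :=
    Ioo_mem_nhdsGT one_pos
  obtain ⟨t, ht, h0, h1⟩ := (h1.and h2).exists
  refine ⟨_, ht, ?_⟩
  have hl := k.leg_pos
  have ht := tau_pos
  rw [centroid, pt_add_smul]
  refine ⟨_, _, ?_, ?_, ?_, rfl⟩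
  · nlinarith [mul_nonneg (sub_nonneg.2 h1.le) hx, mul_pos h0 ht]
  · nlinarith [mul_nonneg (sub_nonneg.2 h1.le) hy, mul_pos h0 hl]
  · nlinarith [mul_le_mul_of_nonneg_left hxy (sub_nonneg.2 h1.le), mul_pos h0 (mul_pos ht hl)]

theorem Valid.interior_region (h : F.Valid) : interior (region k F) = cell k F := by
  apply subset_antisymm _ (interior_maximal cell_subset_region h.isOpen_cell)
  intro z hz
  -- An interior point may be moved slightly away from the centroid. If one of the three
  -- inequalities were not strict at the point, this move would violate it.
  have hc : Filter.Tendsto (fun t : ℝ => z + (-t : ℝ) * (centroid k F - z))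
      (nhdsWithin 0 (Set.Ioi 0)) (nhds z) := by
    have : Continuous (fun t : ℝ => z + (-t : ℝ) * (centroid k F - z)) := by fun_prop
    have := this.tendsto 0
    simp only [neg_zero, Complex.ofReal_zero, zero_mul, add_zero] at this
    exact this.mono_left nhdsWithin_le_nhds
  have h1 := hc.eventually (mem_interior_iff_mem_nhds.1 hz)
  obtain ⟨t, ht, h0⟩ := (h1.and self_mem_nhdsWithin).exists
  replace ht : z + (-t : ℝ) * (centroid k F - z) ∈ region k F := ht
  replace h0 : 0 < t := h0
  obtain ⟨x, y, -, -, -, rfl⟩ := interior_subset hz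
  have hl := k.leg_pos
  have htau := tau_pos
  rw [centroid, pt_add_smul, h.region_eq, Set.mem_ofPred_eq, h.cx_pt, h.cy_pt] at ht
  obtain ⟨hx, hy, hxy⟩ := ht
  refine ⟨x, y, ?_, ?_, ?_, rfl⟩
  · by_contra! hneg
    nlinarith [mul_pos h0 htau]
  · by_contra! hneg
    nlinarith [mul_pos h0 hl]
  · by_contra! hneg
    nlinarith [mul_pos h0 (mul_pos htau hl)]

end Frame

/-! ### Tile systems, dissection and composition -/

open Frame RobinsonTriangle

/-- Every side of the tile of kind `k` at `F` is a side, with the same arrow, of a tile of the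
family `P` on the other side of it. -/
def HasMates (P : RobinsonKind → Frame → Prop) (k : RobinsonKind) (F : Frame) : Prop :=
  match k with
  -- The three conjuncts belong to the sides ab, ac, cb in this order.
  | .halfKite => P .halfKite F.mE ∧ (P .halfKite F.mF ∨ P .halfDart F.eta) ∧
      (P .halfKite F.be ∨ P .halfDart F.ka)
  | .halfDart => P .halfDart F.mF ∧ (P .halfKite F.ka ∨ P .halfDart F.de) ∧
      (P .halfDart F.mE ∨ P .halfKite F.etaInv)

/-- A family of tiles with disjoint interiors. -/
structure Packing (P : RobinsonKind → Frame → Prop) : Prop where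
  valid : ∀ {k F}, P k F → F.Valid
  disjoint : ∀ {k l F G}, P k F → P l G → (cell k F ∩ cell l G).Nonempty → k = l ∧ F = G

/-- A family of tiles with disjoint interiors that can be continued across every side. -/
structure TileSystem (P : RobinsonKind → Frame → Prop) : Prop extends Packing P where
  hasMates : ∀ {k F}, P k F → HasMates P k F

/-- The tiles into which a tile is dissected after dilation by the golden ratio. -/
inductive Child : RobinsonKind → Frame → RobinsonKind → Frame → Prop
  | kite_dart (F : Frame) : Child .halfKite F .halfDart F.sc
  | kite_kite (F : Frame) : Child .halfKite F .halfKite F.sc.ka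
  | kite_kite' (F : Frame) : Child .halfKite F .halfKite F.sc.ka.mE
  | dart_dart (F : Frame) : Child .halfDart F .halfDart F.sc.nu
  | dart_kite (F : Frame) : Child .halfDart F .halfKite F.sc.nu.ka

/-- The family composed from a family of tiles, scaled down by the golden ratio. -/
def compose (P : RobinsonKind → Frame → Prop) (k : RobinsonKind) (F : Frame) : Prop :=
  match k with
  -- Only a half-dart and the tile across its base are recorded; that second tile lies outside the
  -- composed triangle. The half-kites inside the composed triangle are then forced.
  | .halfKite => P .halfDart F.sc ∧ P .halfDart F.sc.mE
  | .halfDart => P .halfDart F.sc.nu ∧ P .halfKite F.sc.nu.etaInv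

/-- A dilated tile is covered by the tiles into which it is dissected. -/
theorem exists_child_region {k : RobinsonKind} {F : Frame} {z : ℂ} (hz : z ∈ region k F) :
    ∃ l G, Child k F l G ∧ tau * z ∈ region l G := by
  have h2 := tau_sq
  have h3 := ofReal_tau_sq
  have h0 := tau_pos
  obtain ⟨x, y, hx, hy, hxy, rfl⟩ := hz
  cases k
  · rw [leg_halfKite] at hxy
    have hxy' : x + y ≤ tau := by nlinarith
    -- In undilated coordinates, the line x + τy = 1 cuts off the half-dart and τx + y = τ separates
    -- the two half-kites. For the half-dart below, the cut is x + y = 1.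
    by_cases c1 : x + tau * y ≤ 1
    · refine ⟨_, _, .kite_dart F, tau * x, tau * y, by positivity, by positivity, ?_, ?_⟩
      · rw [leg_halfDart]
        nlinarith
      · simp [pt]
        ring
    by_cases c2 : tau * x + y ≤ tau
    · refine ⟨_, _, .kite_kite F, tau * x, tau * (tau - tau * x - y), by positivity, ?_, ?_, ?_⟩
      · exact mul_nonneg h0.le (by linarith)
      · rw [leg_halfKite]
        nlinarith
      · simp [pt]
        grind
    · refine ⟨_, _, .kite_kite' F, tau ^ 2 * (tau - x - y), tau * (tau * x + y - tau), ?_, ?_, ?_,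
        ?_⟩
      · exact mul_nonneg (by positivity) (by linarith)
      · exact mul_nonneg h0.le (by linarith)
      · rw [leg_halfKite]
        nlinarith
      · simp [pt]
        grind
  · rw [leg_halfDart] at hxy
    by_cases c1 : x + y ≤ 1
    · refine ⟨_, _, .dart_kite F, tau * y, tau * x, by positivity, by positivity, ?_, ?_⟩
      · rw [leg_halfKite]
        nlinarith
      · simp [pt]
        grind
    · refine ⟨_, _, .dart_dart F, tau * y, tau * (tau - x - tau * y), by positivity, ?_, ?_, ?_⟩
      · exact mul_nonneg h0.le (by linarith)
      · rw [leg_halfDart]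
        nlinarith
      · simp [pt]
        grind

/-! ### Neighbours excluded by overlaps and by angle counts -/

namespace Packing

variable {P : RobinsonKind → Frame → Prop}

/-- All overlaps below are certified by one explicit point, given by its coordinates in both frames.
The witnesses are convenient points of the intersection with coordinates in ℚ(τ). -/
theorem eq_of_pt (hP : Packing P) {k l : RobinsonKind} {F G : Frame} (hF : P k F) (hG : P l G)
    (x y x' y' : ℝ)
    (hx : 0 < x) (hy : 0 < y) (hxy : k.leg * x + tau * y < tau * k.leg)
    (hx' : 0 < x') (hy' : 0 < y') (hxy' : l.leg * x' + tau * y' < tau * l.leg)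
    (h : F.pt x y = G.pt x' y') : k = l ∧ F = G :=
  hP.disjoint hF hG ⟨_, ⟨x, y, hx, hy, hxy, rfl⟩, ⟨x', y', hx', hy', hxy', h⟩⟩

end Packing

namespace Packing

variable {P : RobinsonKind → Frame → Prop} {F : Frame}

/-- In this lemma and the next, two candidates for the neighbour across the same side lie on the
same side of it and overlap. In the two after that, a neighbour is mirrored back onto the tile it
came from. -/
theorem not_kite_etaInv (hP : Packing P) (h : P .halfDart F.mE) : ¬ P .halfKite F.etaInv := by
  intro h'
  have h1 := tau_gt
  have h2 := tau_lt
  have h3 := ofReal_tau_sq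
  have h4 := tau_sq
  have := (hP.eq_of_pt h h' (1 - 1 / 3 * tau) (1 / 3)
    (1 / 3) (-1 + tau) (by linarith) (by linarith) (by rw [leg_halfDart]; nlinarith)
    (by linarith) (by linarith) (by rw [leg_halfKite]; nlinarith) (by simp [pt]; grind)).1
  cases this

theorem not_dart_eta (hP : Packing P) (h : P .halfKite F.mF) : ¬ P .halfDart F.eta := by
  intro h'
  have h1 := tau_gt
  have h2 := tau_lt
  have h3 := ofReal_tau_sq
  have h4 := tau_sq
  have := (hP.eq_of_pt h h' (3 / 8) (5 / 4 - 3 / 8 * tau)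
    (-5 / 4 + tau) (3 / 8) (by linarith) (by linarith) (by rw [leg_halfKite]; nlinarith)
    (by linarith) (by linarith) (by rw [leg_halfDart]; nlinarith) (by simp [pt]; grind)).1
  cases this

theorem not_dart_de_ka (hP : Packing P) (h : P .halfKite F) : ¬ P .halfDart F.ka.de := by
  intro h'
  have h1 := tau_gt
  have h2 := tau_lt
  have h3 := ofReal_tau_sq
  have h4 := tau_sq
  have := (hP.eq_of_pt h h' (1 / 3) (1)
    (-1 + tau) (1 / 3) (by linarith) (by linarith) (by rw [leg_halfKite]; nlinarith)
    (by linarith) (by linarith) (by rw [leg_halfDart]; nlinarith) (by simp [pt]; grind)).1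
  cases this

theorem not_kite_be_ka (hP : Packing P) (h : P .halfDart F) : ¬ P .halfKite F.ka.be := by
  intro h'
  have h1 := tau_gt
  have h2 := tau_lt
  have h3 := ofReal_tau_sq
  have h4 := tau_sq
  have := (hP.eq_of_pt h h' (5 / 8) (1 / 4)
    (-3 / 4 + 5 / 8 * tau) (-5 / 8 + tau) (by linarith) (by linarith) (by rw [leg_halfDart]; nlinarith)
    (by linarith) (by linarith) (by rw [leg_halfKite]; nlinarith) (by simp [pt]; grind)).1
  cases this

end Packing

/-- Exchanging the ends of the base turns the single leg into a double leg, so the forced half-kite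
across it falls on the mirror image of the original half-dart in that leg. -/
theorem Frame.cell_mF_inter_cell_flip_ka (F : Frame) :
    (cell .halfDart F.mF ∩ cell .halfKite F.flip.ka).Nonempty := by
  have h1 := tau_gt
  have h2 := tau_lt
  have h3 := ofReal_tau_sq
  have h4 := tau_sq
  refine ⟨_, ⟨11 / 20, 23 / 20 - 11 / 20 * tau, by linarith, by linarith, ?_, rfl⟩,
    ⟨11 / 20 - 3 / 20 * tau, 3 / 5 * tau, by linarith, by linarith, ?_, ?_⟩⟩
  · rw [leg_halfDart]
    nlinarith
  · rw [leg_halfKite]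
    nlinarith
  · simp [pt]
    grind

namespace TileSystem

variable {P : RobinsonKind → Frame → Prop} {F : Frame}

/-- The two half-darts and their mirror images in the single legs would put four angles of 108°
around the common apex. -/
theorem not_dart_de (hP : TileSystem P) (h : P .halfDart F) : ¬ P .halfDart F.de := by
  intro h'
  have h1 := tau_gt
  have h2 := tau_lt
  have h3 := ofReal_tau_sq
  have h4 := tau_sq
  have := (hP.eq_of_pt (hP.hasMates h).1 (hP.hasMates h').1 (3 / 4) (3 / 2 - 3 / 4 * tau)
    (-1 / 2 + 3 / 4 * tau) (1 / 4) (by linarith) (by linarith) (by rw [leg_halfDart]; nlinarith)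
    (by linarith) (by linarith) (by rw [leg_halfDart]; nlinarith) (by simp [pt]; grind)).2
  have ho : F.pt 0 0 = F.pt (-1) (tau ^ 2) := by
    simp only [Frame.ext_iff, mF_o, de_o] at this
    simp [pt]
    grind
  linarith [((hP.valid h).pt_inj ho).1]

theorem kite_ka (hP : TileSystem P) (h : P .halfDart F) : P .halfKite F.ka :=
  (hP.hasMates h).2.1.resolve_right (hP.not_dart_de h)

/-- Six base angles of 72° would meet at the vertex b: those of `F`, `F.mE`, of their mirror images
in the bases, and of the mirror images of these in their single legs. -/
theorem not_kite_be_mE (hP : TileSystem P) (hF : P .halfKite F) (h : P .halfKite F.be) :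
    ¬ P .halfKite F.mE.be := by
  intro h'
  have h1 := tau_gt
  have h2 := tau_lt
  have h3 := ofReal_tau_sq
  have h4 := tau_sq
  have := (hP.eq_of_pt (hP.hasMates h).1 (hP.hasMates h').1 (1 - 1 / 3 * tau) (7 / 3 - tau)
    (1 - 1 / 3 * tau) (7 / 3 - tau) (by linarith) (by linarith) (by rw [leg_halfKite]; nlinarith)
    (by linarith) (by linarith) (by rw [leg_halfKite]; nlinarith) (by simp [pt]; grind)).2
  have ho : F.pt tau 0 = F.pt 0 2 := by
    simp only [Frame.ext_iff, mE_o, be_o, mE_e, be_e, mE_f] at this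
    simp [pt]
    grind
  linarith [((hP.valid hF).pt_inj ho).1]

/-- At b, the half-kites `F`, `F.mE`, `F.be`, `F.be.mE` take 4 · 72°, and the half-dart `F.mE.ka`
with the half-kite `F.mE.ka.etaInv` takes the remaining 36° + 36°. Hence neither tile that could lie
across the base of `F.be.mE` fits; `not_dart_ka_mE_be` treats the other one. -/
theorem not_kite_be_mE_be (hP : TileSystem P) (hF : P .halfKite F)
    (h : P .halfKite F.mE.ka.etaInv) : ¬ P .halfKite F.be.mE.be := by
  intro h'
  have h1 := tau_gt
  have h2 := tau_lt
  have h3 := ofReal_tau_sq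
  have h4 := tau_sq
  have := (hP.eq_of_pt h h' (-1 + 4 / 5 * tau) (-29 / 10 + 21 / 10 * tau)
    (-29 / 10 + 2 * tau) (-21 / 10 + 19 / 10 * tau) (by linarith) (by linarith) (by rw [leg_halfKite]; nlinarith)
    (by linarith) (by linarith) (by rw [leg_halfKite]; nlinarith) (by simp [pt]; grind)).2
  have ho : F.pt tau (-tau) = F.pt 0 1 := by
    have := congrArg Frame.f this
    simp at this
    simp [pt]
    grind
  linarith [((hP.valid hF).pt_inj ho).1]

theorem not_dart_ka_mE_be (hP : TileSystem P)
    (h : P .halfKite F.mE.ka.etaInv) : ¬ P .halfDart F.be.mE.ka := by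
  intro h'
  have h1 := tau_gt
  have h2 := tau_lt
  have h3 := ofReal_tau_sq
  have h4 := tau_sq
  have := (hP.eq_of_pt h h' (-1 + 5 / 6 * tau) (-10 / 3 + 5 / 2 * tau)
    (5 / 2 - 4 / 3 * tau) (-1 + 5 / 6 * tau) (by linarith) (by linarith) (by rw [leg_halfKite]; nlinarith)
    (by linarith) (by linarith) (by rw [leg_halfDart]; nlinarith) (by simp [pt]; grind)).1
  cases this

/-- If two half-darts share their base, then the second half-kite of the composed half-kite is not
next to the base of a half-dart. -/
theorem not_dart_ka_mE_ka (hP : TileSystem P)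
    (h : P .halfDart F.mE) : ¬ P .halfDart F.ka.mE.ka := by
  intro h'
  have h1 := tau_gt
  have h2 := tau_lt
  have h3 := ofReal_tau_sq
  have h4 := tau_sq
  have := (hP.eq_of_pt (hP.hasMates (hP.kite_ka h)).1 h' (3 / 2 - 3 / 4 * tau) (-1 + 5 / 4 * tau)
    (1 - 1 / 4 * tau) (11 / 4 - 3 / 2 * tau) (by linarith) (by linarith) (by rw [leg_halfKite]; nlinarith)
    (by linarith) (by linarith) (by rw [leg_halfDart]; nlinarith) (by simp [pt]; grind)).1
  cases this

theorem dart_mE_or_kite_etaInv (hP : TileSystem P) (h : P .halfDart F) :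
    P .halfDart F.mE ∨ P .halfKite F.etaInv :=
  (hP.hasMates h).2.2

/-- A half-kite with another half-kite across its base is the second half-kite of a composed
half-kite. -/
theorem dart_of_kite_be (hP : TileSystem P) (hF : P .halfKite F) (h : P .halfKite F.be) :
    P .halfDart F.mE.ka ∧ P .halfDart F.mE.ka.mE := by
  obtain h1 | h1 := (hP.hasMates (hP.hasMates hF).1).2.2
  · exact (hP.not_kite_be_mE hF h h1).elim
  refine ⟨h1, (hP.dart_mE_or_kite_etaInv h1).resolve_right fun h2 => ?_⟩
  obtain h3 | h3 := (hP.hasMates (hP.hasMates h).1).2.2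
  · exact hP.not_kite_be_mE_be hF h2 h3
  · exact hP.not_dart_ka_mE_be h2 h3

/-- No half-kite is left over by composition: it is attached by its base to a half-dart, or it is
the second half-kite of a composed half-kite. -/
theorem dart_ka_or (hP : TileSystem P) (hF : P .halfKite F) :
    P .halfDart F.ka ∨ P .halfDart F.mE.ka ∧ P .halfDart F.mE.ka.mE :=
  (hP.hasMates hF).2.2.symm.imp_right (hP.dart_of_kite_be hF)

end TileSystem

theorem Frame.valid_of_nu {F : Frame} (h : F.nu.Valid) : F.Valid := by
  have := tau_sq
  obtain ⟨h1, h2, h3⟩ := h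
  simp at h1 h2 h3
  refine ⟨?_, ?_, ?_⟩ <;> grind

theorem Child.valid {k l : RobinsonKind} {F G : Frame} (h : Child k F l G) (hF : F.Valid) :
    G.Valid := by
  cases h with
  | kite_dart => exact hF
  | kite_kite => exact (valid_sc.2 hF).ka
  | kite_kite' => exact (valid_sc.2 hF).ka.mE
  | dart_dart => exact (valid_sc.2 hF).nu
  | dart_kite => exact (valid_sc.2 hF).nu.ka

/-! ### The composed family is again a tile system -/

namespace TileSystem

variable {P : RobinsonKind → Frame → Prop} {F G H : Frame} {k l m : RobinsonKind}

theorem of_child (hP : TileSystem P) (h : compose P k F) (hc : Child k F l G) : P l G := by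
  cases hc with
  | kite_dart => exact h.1
  | kite_kite => exact hP.kite_ka h.1
  | kite_kite' => exact (hP.hasMates (hP.kite_ka h.1)).1
  | dart_dart => exact h.1
  | dart_kite => exact hP.kite_ka h.1

/-- Each child leads back to the half-dart of its parent, and the tile across the base of that
half-dart tells the kind of the parent (`mixed`). The second half-kite of a composed half-kite
cannot be confused with a half-kite attached to a half-dart (`kites`). -/
theorem child_unique (hP : TileSystem P) (hF : compose P k F) (hG : compose P l G)
    (hFH : Child k F m H) (hGH : Child l G m H) : k = l ∧ F = G := by
  have kites : ∀ {F G : Frame}, compose P .halfKite F → P .halfDart G → F.sc.ka.mE ≠ G.ka := by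
    intro F G hF hG h
    apply hP.not_dart_ka_mE_ka hF.2
    rwa [h, ka_ka]
  have mixed : ∀ {F G : Frame}, compose P .halfKite F → compose P .halfDart G →
      F.sc ≠ G.sc.nu := by
    intro F G hF hG h
    apply hP.not_kite_etaInv hF.2
    rw [h]
    exact hG.2
  -- A second name for `H` lets both case distinctions succeed and leaves the equation between the
  -- two children as `hH`.
  obtain ⟨H', hH⟩ : ∃ H', H' = H := ⟨H, rfl⟩
  rw [← hH] at hFH
  cases hFH <;> cases hGH
  · exact ⟨rfl, sc_injective hH⟩
  · exact (mixed hF hG hH).elim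
  · exact ⟨rfl, sc_injective (ka_injective hH)⟩
  · exact (kites hG hF.1 hH.symm).elim
  · exact (mixed hF hG (ka_injective hH)).elim
  · exact (kites hF hG.1 hH).elim
  · exact ⟨rfl, sc_injective (ka_injective (mE_injective hH))⟩
  · exact (kites hF hG.1 hH).elim
  · exact (mixed hG hF hH.symm).elim
  · exact ⟨rfl, sc_injective (nu_injective hH)⟩
  · exact (mixed hG hF (ka_injective hH).symm).elim
  · exact (kites hG hF.1 hH.symm).elim
  · exact ⟨rfl, sc_injective (nu_injective (ka_injective hH))⟩

theorem exists_child_cell (k : RobinsonKind) (F : Frame) {W : Set ℂ} (hW : IsOpen W)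
    (h : (W ∩ cell k F).Nonempty) :
    ∃ l G, Child k F l G ∧ (((fun z => (tau : ℂ) * z) '' W) ∩ cell l G).Nonempty := by
  obtain ⟨z, hz, hzF⟩ := h
  obtain ⟨l, G, hc, hG⟩ := exists_child_region (cell_subset_region hzF)
  have ht : (tau : ℂ) ≠ 0 := by exact_mod_cast tau_pos.ne'
  exact ⟨l, G, hc, inter_cell_nonempty ((Homeomorph.mulLeft₀ _ ht).isOpenMap _ hW)
    ⟨_, Set.mem_image_of_mem _ hz, hG⟩⟩

theorem compose_valid (hP : TileSystem P) (h : compose P k F) : F.Valid := by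
  cases k
  · exact valid_sc.1 (hP.valid h.1)
  · exact valid_sc.1 (valid_of_nu (hP.valid h.1))

/-- The dilated overlap contains an open set common to a child of one tile and a child of the other.
These children belong to `P`, so they are equal, and a child determines its parent. -/
theorem compose_disjoint (hP : TileSystem P) (hF : compose P k F) (hG : compose P l G)
    (h : (cell k F ∩ cell l G).Nonempty) : k = l ∧ F = G := by
  have oF := (hP.compose_valid hF).isOpen_cell (k := k)
  have oG := (hP.compose_valid hG).isOpen_cell (k := l)
  obtain ⟨m, H, hc, hH⟩ := exists_child_cell k F (oF.inter oG) (by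
    rw [Set.inter_right_comm, Set.inter_self]; exact h)
  have hmH := hP.of_child hF hc
  have ht : (tau : ℂ) ≠ 0 := by exact_mod_cast tau_pos.ne'
  have hcont : Continuous fun z => (tau : ℂ) * z := by fun_prop
  obtain ⟨m', H', hc', z, ⟨y, hy, rfl⟩, hzH'⟩ := exists_child_cell l G
    (W := cell l G ∩ (fun z => (tau : ℂ) * z) ⁻¹' cell m H)
    (oG.inter ((hP.valid hmH).isOpen_cell.preimage hcont)) (by
      obtain ⟨_, ⟨y, hy, rfl⟩, hyH⟩ := hH
      exact ⟨y, ⟨hy.2, hyH⟩, hy.2⟩)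
  obtain ⟨rfl, rfl⟩ := hP.disjoint hmH (hP.of_child hG hc') ⟨_, hy.2, hzH'⟩
  exact hP.child_unique hF hG hc hc'

/-- The single leg is immediate, as the defining pair of half-darts is symmetric in it. Each other
side of the composed triangle carries a side of a child, and the tile across that side is a child of
the composed neighbour sought. The half-dart case works in the same way. -/
theorem compose_hasMates_halfKite (hP : TileSystem P) (h : compose P .halfKite F) :
    HasMates (compose P) .halfKite F := by
  have ht := ofReal_tau_sq
  obtain ⟨hF, hFE⟩ := h
  have e1 : F.sc.mF = F.eta.sc.nu := by ext <;> simp <;> grind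
  refine ⟨⟨hFE, ?_⟩, ?_, ?_⟩
  · have : F.mE.sc.mE = F.sc := by ext <;> simp
    rwa [this]
  · have h1 := (hP.hasMates hF).1
    refine (hP.dart_mE_or_kite_etaInv h1).imp (fun h2 => ⟨h1, h2⟩) fun h2 => ?_
    rw [e1] at h1 h2
    exact ⟨h1, h2⟩
  · have h1 := hP.kite_ka hF
    have h2 := (hP.hasMates h1).1
    obtain h3 | h3 := (hP.hasMates h2).2.1
    -- The half-kite `h3` across the base is not attached to a half-dart, so it is itself the second
    -- half-kite of a composed half-kite, the one at `F.be`.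
    · left
      have h4 : ¬ P .halfDart F.sc.ka.mE.mF.ka := by
        intro h4
        apply hP.not_dart_ka_mE_ka hFE
        have := (hP.hasMates h4).1
        have e : F.sc.ka.mE.mF.ka.mF = F.sc.ka.mE.ka := by ext <;> simp <;> grind
        rwa [e] at this
      have h5 := (hP.dart_ka_or h3).resolve_left h4
      have e : F.sc.ka.mE.mF.mE.ka = F.be.sc := by ext <;> simp <;> grind
      rwa [e] at h5
    · right
      have e : F.sc.ka.mE.eta = F.ka.sc.nu := by ext <;> simp <;> grind
      have e' : F.sc.ka.mE = F.ka.sc.nu.etaInv := by ext <;> simp <;> grind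
      rw [e] at h3
      rw [e'] at h2
      exact ⟨h3, h2⟩

theorem compose_hasMates_halfDart (hP : TileSystem P) (h : compose P .halfDart F) :
    HasMates (compose P) .halfDart F := by
  have ht := ofReal_tau_sq
  obtain ⟨hF, hFk⟩ := h
  refine ⟨?_, .inl ?_, ?_⟩
  · have h1 := (hP.hasMates (hP.kite_ka hF)).1
    -- Were this half-kite not attached to a half-dart, it would be a second half-kite, and a
    -- half-dart instead of `hFk` would lie across the base of `F.sc.nu`.
    have h2 : P .halfDart F.sc.nu.ka.mE.ka := by
      refine (hP.hasMates h1).2.2.resolve_left fun h2 => ?_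
      have h3 := (hP.dart_of_kite_be h1 h2).2
      rw [mE_mE, ka_ka] at h3
      exact hP.not_kite_etaInv h3 hFk
    have h3 : ¬ P .halfDart F.sc.nu.ka.mE.ka.mE := by
      intro h3
      apply hP.not_dart_ka_mE_ka h3
      rwa [ka_ka, mE_mE, ka_ka]
    have h4 := (hP.dart_mE_or_kite_etaInv h2).resolve_left h3
    have e : F.sc.nu.ka.mE.ka = F.mF.sc.nu := by ext <;> simp
    rw [e] at h2 h4
    exact ⟨h2, h4⟩
  -- Such a half-dart has a mirror image in its single leg, whose forced half-kite would overlap the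
  -- half-dart at `F.sc.nu`.
  · have h1 : ¬ P .halfDart F.sc.nu.etaInv.ka := by
      intro h1
      have h2 := hP.kite_ka (hP.hasMates h1).1
      have e : F.sc.nu.etaInv.ka.mF.ka = F.sc.nu.etaInv.mF := by ext <;> simp <;> grind
      rw [e] at h2
      apply hP.not_dart_eta h2
      have e : F.sc.nu.etaInv.eta = F.sc.nu := by ext <;> simp <;> ring
      rwa [e]
    have h2 := (hP.dart_ka_or hFk).resolve_left h1
    have e : F.sc.nu.etaInv.mE.ka = F.ka.sc := by ext <;> simp <;> grind
    rwa [e] at h2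
  · have h1 := (hP.hasMates hF).1
    refine (hP.dart_mE_or_kite_etaInv h1).symm.imp (fun h2 => ?_) (fun h2 => ?_)
    · have e : F.sc.nu.mF = F.mE.sc.nu := by ext <;> simp <;> grind
      rw [e] at h1 h2
      exact ⟨h1, h2⟩
    · have e : F.sc.nu.mF = F.etaInv.sc := by ext <;> simp <;> grind
      rw [e] at h1 h2
      exact ⟨h1, h2⟩

/-- The family composed from a tile system is a tile system. -/
theorem compose (hP : TileSystem P) : TileSystem (compose P) where
  valid := hP.compose_valid
  disjoint := hP.compose_disjoint
  hasMates := by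
    intro k F h
    cases k
    · exact hP.compose_hasMates_halfKite h
    · exact hP.compose_hasMates_halfDart h

end TileSystem

/-! ### Tile systems have no periods -/

/-- In frame coordinates ‖w‖² = a² + τab + b² ≥ (1 − τ/2)(a² + b²), so ‖w‖ < 0.04 gives |a|, |b| <
0.1, within the slack of the centroid in every inequality. -/
theorem Frame.Valid.centroid_add_mem_cell {F : Frame} (h : F.Valid) (k : RobinsonKind) {w : ℂ}
    (hw : ‖w‖ < 0.04) : centroid k F + w ∈ cell k F := by
  have t1 := tau_gt
  have t2 := tau_lt
  have hpt := h.pt_cx_cy (F.o + w)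
  set a := F.cx (F.o + w)
  set b := F.cy (F.o + w)
  have hw' : w = a * F.e + b * F.f := by
    simp only [pt] at hpt
    linear_combination -hpt
  have hN : a ^ 2 + tau * a * b + b ^ 2 < 0.0016 := by
    have h1 : ‖w‖ ^ 2 = a ^ 2 + tau * a * b + b ^ 2 := by
      obtain ⟨e1, e2, e3⟩ := h
      rw [Complex.sq_norm, Complex.normSq_apply, hw']
      simp
      linear_combination a ^ 2 * e1 + b ^ 2 * e2 + 2 * a * b * e3
    rw [← h1]
    nlinarith [norm_nonneg w]
  have hN' : a ^ 2 + b ^ 2 < 0.1 ^ 2 := by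
    nlinarith [mul_nonneg (sub_nonneg.2 t2.le) (add_nonneg (sq_nonneg a) (sq_nonneg b)),
      mul_nonneg tau_pos.le (sq_nonneg (a + b))]
  have ha := abs_lt_of_sq_lt_sq' (by nlinarith [sq_nonneg b] : a ^ 2 < 0.1 ^ 2) (by norm_num)
  have hb := abs_lt_of_sq_lt_sq' (by nlinarith [sq_nonneg a] : b ^ 2 < 0.1 ^ 2) (by norm_num)
  refine ⟨tau / 3 + a, k.leg / 3 + b, ?_, ?_, ?_, ?_⟩
  · linarith [ha.1]
  · cases k
    · rw [leg_halfKite]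
      linarith [hb.1]
    · rw [leg_halfDart]
      linarith [hb.1]
  · cases k
    · rw [leg_halfKite]
      nlinarith [ha.2, hb.2]
    · rw [leg_halfDart]
      nlinarith [ha.2, hb.2]
  · simp only [pt, centroid, hw']
    push_cast
    ring

theorem Frame.Valid.cell_inter_cell_shift {F : Frame} (h : F.Valid) (k : RobinsonKind) {w : ℂ}
    (hw : ‖w‖ < 0.04) : (cell k F ∩ cell k (F.shift w)).Nonempty := by
  refine ⟨_, h.centroid_add_mem_cell k hw, ?_⟩
  convert centroid_mem_cell (k := k) (F := F.shift w) using 1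
  simp only [pt, centroid, shift_o, shift_e, shift_f]
  ring

/-- The family is mapped into itself by the translation by `v`. -/
def HasPeriod (P : RobinsonKind → Frame → Prop) (v : ℂ) : Prop :=
  ∀ k F, P k F → P k (F.shift v)

/-- Composition is defined by memberships in `P` without negations, so invariance in one direction
passes on. -/
theorem HasPeriod.compose {P : RobinsonKind → Frame → Prop} {v : ℂ} (h : HasPeriod P v) :
    HasPeriod (compose P) (v / tau) := by
  have ht : (tau : ℂ) ≠ 0 := by exact_mod_cast tau_pos.ne'
  intro k F hF
  cases k
  · refine ⟨?_, ?_⟩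
    · convert h _ _ hF.1 using 1
      ext <;> simp
      field_simp
    · convert h _ _ hF.2 using 1
      ext <;> simp
      field_simp
  · refine ⟨?_, ?_⟩
    · convert h _ _ hF.1 using 1
      ext <;> simp
      field_simp
      ring
    · convert h _ _ hF.2 using 1
      ext <;> simp
      field_simp
      ring

namespace TileSystem

variable {P : RobinsonKind → Frame → Prop}

theorem exists_halfDart (hP : TileSystem P) (h : ∃ k F, P k F) : ∃ F, P .halfDart F := by
  obtain ⟨k, F, h⟩ := h
  cases k
  · obtain h | h := hP.dart_ka_or h
    exacts [⟨_, h⟩, ⟨_, h.1⟩]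
  · exact ⟨_, h⟩

theorem exists_compose (hP : TileSystem P) (h : ∃ k F, P k F) : ∃ k F, _root_.compose P k F := by
  obtain ⟨F, h⟩ := hP.exists_halfDart h
  have ht : (tau : ℂ) ≠ 0 := by exact_mod_cast tau_pos.ne'
  obtain h' | h' := hP.dart_mE_or_kite_etaInv h
  · refine ⟨.halfKite, ⟨F.o / tau, F.e, F.f⟩, ?_⟩
    have e : (⟨F.o / tau, F.e, F.f⟩ : Frame).sc = F := by
      ext <;> simp
      field_simp
    exact ⟨by rwa [e], by rwa [e]⟩
  · refine ⟨.halfDart, ⟨(F.o + tau ^ 2 * F.f) / tau, -F.f, F.e - tau * F.f⟩, ?_⟩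
    have e : (⟨(F.o + tau ^ 2 * F.f) / tau, -F.f, F.e - tau * F.f⟩ : Frame).sc.nu = F := by
      ext <;> simp
      field_simp
      ring
    exact ⟨by rwa [e], by rwa [e]⟩

theorem eq_zero_of_hasPeriod_of_norm_lt (hP : TileSystem P) (h : ∃ k F, P k F) {v : ℂ}
    (hv : HasPeriod P v) (hlt : ‖v‖ < 0.04) : v = 0 := by
  obtain ⟨k, F, h⟩ := h
  have := (hP.disjoint h (hv k F h) ((hP.valid h).cell_inter_cell_shift k hlt)).2
  simpa using congrArg Frame.o this

/-- A tile system has no nontrivial period. -/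
theorem eq_zero_of_hasPeriod {v : ℂ} (hP : TileSystem P) (h : ∃ k F, P k F)
    (hv : HasPeriod P v) : v = 0 := by
  -- Each composition divides the period by τ and keeps the system nonempty; for large n the period
  -- is shorter than 0.04.
  have key : ∀ n : ℕ, ∃ Q, TileSystem Q ∧ (∃ k F, Q k F) ∧ HasPeriod Q (v / tau ^ n) := by
    intro n
    induction n with
    | zero => exact ⟨P, hP, h, by simpa using hv⟩
    | succ n ih =>
      obtain ⟨Q, h1, h2, h3⟩ := ih
      refine ⟨_, h1.compose, h1.exists_compose h2, ?_⟩
      rw [pow_succ, ← div_div]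
      exact h3.compose
  have ht : 1 < tau := by linarith [tau_gt]
  obtain ⟨n, hn⟩ := pow_unbounded_of_one_lt (‖v‖ / 0.04) ht
  obtain ⟨Q, h1, h2, h3⟩ := key n
  have h0 : (tau : ℂ) ^ n ≠ 0 := pow_ne_zero _ (by exact_mod_cast tau_pos.ne')
  have h4 := h1.eq_zero_of_hasPeriod_of_norm_lt h2 h3 (by
    rw [norm_div, norm_pow, Complex.norm_real, Real.norm_of_nonneg tau_pos.le,
      div_lt_iff₀ (pow_pos tau_pos n)]
    rw [div_lt_iff₀ (by norm_num)] at hn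
    linarith)
  simpa [h0, tau_pos.ne'] using h4

end TileSystem

/-! ### Plane geometry of triangles given by their vertices -/

/-- The frame at the first vertex of a triangle given by two of its sides. -/
def triFrame (p q r : ℂ) : Frame := ⟨p, q - p, r - p⟩

theorem triFrame_pt (p q r : ℂ) (x y : ℝ) :
    (triFrame p q r).pt x y = (1 - x - y : ℝ) * p + x * q + y * r := by
  simp [triFrame, pt]
  ring

theorem mem_convexHull_triple {p q r z : ℂ} : z ∈ convexHull ℝ {p, q, r} ↔
    ∃ x y : ℝ, 0 ≤ x ∧ 0 ≤ y ∧ x + y ≤ 1 ∧ z = (triFrame p q r).pt x y := by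
  constructor
  · intro hz
    have hsub : convexHull ℝ {p, q, r} ⊆
        {z | ∃ x y : ℝ, 0 ≤ x ∧ 0 ≤ y ∧ x + y ≤ 1 ∧ z = (triFrame p q r).pt x y} := by
      apply convexHull_min
      · rintro w (rfl | rfl | rfl)
        · exact ⟨0, 0, by simp [triFrame, pt]⟩
        · exact ⟨1, 0, by simp [triFrame, pt]⟩
        · exact ⟨0, 1, by simp [triFrame, pt]⟩
      · rintro _ ⟨x, y, hx, hy, hxy, rfl⟩ _ ⟨x', y', hx', hy', hxy', rfl⟩ a b ha hb hab
        refine ⟨a * x + b * x', a * y + b * y', by positivity, by positivity, ?_, ?_⟩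
        · nlinarith
        · have : (a : ℂ) + b = 1 := by exact_mod_cast hab
          simp only [triFrame, pt, Complex.real_smul]
          push_cast
          linear_combination p * this
    exact hsub hz
  · rintro ⟨x, y, hx, hy, hxy, rfl⟩
    rw [triFrame_pt]
    have := (convex_convexHull ℝ {p, q, r}).sum_mem (t := Finset.univ)
      (w := ![1 - x - y, x, y]) (z := ![p, q, r])
      (by intro i _; fin_cases i <;> simp <;> linarith) (by simp [Fin.sum_univ_three]; ring)
      (by intro i _; apply subset_convexHull; fin_cases i <;> simp)
    simpa [Fin.sum_univ_three] using this

theorem mem_openSegment_iff_pt {p q r z : ℂ} :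
    z ∈ openSegment ℝ p q ↔ ∃ s : ℝ, 0 < s ∧ s < 1 ∧ z = (triFrame p q r).pt s 0 := by
  rw [openSegment_eq_image]
  constructor
  · rintro ⟨s, hs, rfl⟩
    exact ⟨s, hs.1, hs.2, by rw [triFrame_pt]; simp⟩
  · rintro ⟨s, h0, h1, rfl⟩
    exact ⟨s, ⟨h0, h1⟩, by rw [triFrame_pt]; simp⟩

theorem mem_segment_iff_pt {p q r z : ℂ} :
    z ∈ segment ℝ p q ↔ ∃ s : ℝ, 0 ≤ s ∧ s ≤ 1 ∧ z = (triFrame p q r).pt s 0 := by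
  rw [segment_eq_image]
  constructor
  · rintro ⟨s, hs, rfl⟩
    exact ⟨s, hs.1, hs.2, by rw [triFrame_pt]; simp⟩
  · rintro ⟨s, h0, h1, rfl⟩
    exact ⟨s, ⟨h0, h1⟩, by rw [triFrame_pt]; simp⟩

/-- A point inside a side is on no other side. -/
theorem notMem_segment_of_mem_openSegment {p q r z : ℂ} (h : (triFrame p q r).det ≠ 0)
    (hz : z ∈ openSegment ℝ p q) : z ∉ segment ℝ p r ∧ z ∉ segment ℝ q r := by
  obtain ⟨s, h0, h1, rfl⟩ := mem_openSegment_iff_pt (r := r).1 hz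
  constructor
  · rw [segment_eq_image]
    rintro ⟨t, ht, he⟩
    have : (triFrame p q r).pt s 0 = (triFrame p q r).pt 0 t := by
      rw [← he]
      simp [triFrame, pt]
      ring
    linarith [(pt_inj h this).1]
  · rw [segment_eq_image]
    rintro ⟨t, ht, he⟩
    have : (triFrame p q r).pt s 0 = (triFrame p q r).pt (1 - t) t := by
      rw [← he]
      simp [triFrame, pt]
      ring
    have := pt_inj h this
    linarith

/-- The hypotheses give r' the barycentric coordinates α, β, −γ with respect to p, q, r, and γ > 0
puts it beyond the line pq from r. The formula is the resulting change of coordinates, which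
reverses the sign of y. -/
theorem eq_pt_of_opposite {p q r r' : ℂ} {α β γ : ℝ} (hγ : 0 < γ) (hs : α + β = 1 + γ)
    (h : r' + γ * r = α * p + β * q) (x y : ℝ) :
    (triFrame p q r).pt x y = (triFrame p q r').pt (x + y * β / γ) (-y / γ) := by
  have h1 : (γ : ℂ) ≠ 0 := by exact_mod_cast hγ.ne'
  have h2 : (α : ℂ) + β = 1 + γ := by exact_mod_cast hs
  simp only [triFrame, pt]
  push_cast
  field_simp
  linear_combination y * h + y * p * h2

/-- Two triangles on different sides of a common side cover a neighbourhood of every point inside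
that side. -/
theorem union_mem_nhds {p q r r' z : ℂ} {α β γ : ℝ} (hd : (triFrame p q r).det ≠ 0) (hγ : 0 < γ)
    (hs : α + β = 1 + γ) (h : r' + γ * r = α * p + β * q) (hz : z ∈ openSegment ℝ p q) :
    convexHull ℝ {p, q, r} ∪ convexHull ℝ {p, q, r'} ∈ nhds z := by
  set Φ := triFrame p q r with hΦ
  obtain ⟨s, h0, h1, rfl⟩ := mem_openSegment_iff_pt (r := r).1 hz
  have hcx := Φ.continuous_cx
  have hcy := Φ.continuous_cy
  have ev : ∀ (g : ℂ → ℝ), Continuous g → 0 < g (Φ.pt s 0) → ∀ᶠ w in nhds (Φ.pt s 0), 0 < g w :=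
    fun g hg h => hg.continuousAt.eventually (lt_mem_nhds h)
  -- Apart from the sign of `cy`, the inequalities cutting out the two triangles are strict at a
  -- point inside the side, hence hold nearby; the sign then selects the triangle.
  have e1 := ev Φ.cx hcx (by rwa [Frame.cx_pt hd])
  have e2 := ev (fun w => 1 - Φ.cx w - Φ.cy w) (by fun_prop) (by
    simp only [Frame.cx_pt hd, Frame.cy_pt hd]; linarith)
  have e3 := ev (fun w => Φ.cx w + Φ.cy w * β / γ) (by fun_prop) (by
    simp only [Frame.cx_pt hd, Frame.cy_pt hd]; simpa)
  have e4 := ev (fun w => 1 - (Φ.cx w + Φ.cy w * β / γ) - (-Φ.cy w / γ)) (by fun_prop) (by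
    simp only [Frame.cx_pt hd, Frame.cy_pt hd]; simpa)
  filter_upwards [e1, e2, e3, e4] with w h1 h2 h3 h4
  rw [← pt_cx_cy hd w]
  obtain h5 | h5 := le_or_gt 0 (Φ.cy w)
  · left
    exact mem_convexHull_triple.2 ⟨_, _, h1.le, h5, by linarith, rfl⟩
  · right
    rw [eq_pt_of_opposite hγ hs h]
    exact mem_convexHull_triple.2 ⟨_, _, h3.le, (div_pos (by linarith) hγ).le, by linarith, rfl⟩

/-- Two triangles on different sides of a common side meet in that side only. -/
theorem convexHull_inter_convexHull {p q r r' : ℂ} {α β γ : ℝ} (hd : (triFrame p q r).det ≠ 0)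
    (hγ : 0 < γ) (hs : α + β = 1 + γ) (h : r' + γ * r = α * p + β * q) :
    convexHull ℝ {p, q, r} ∩ convexHull ℝ {p, q, r'} = segment ℝ p q := by
  apply subset_antisymm
  · rintro z ⟨h1, h2⟩
    obtain ⟨x, y, hx, hy, hxy, rfl⟩ := mem_convexHull_triple.1 h1
    obtain ⟨x', y', hx', hy', hxy', he⟩ := mem_convexHull_triple.1 h2
    have h' : r + (1 / γ : ℝ) * r' = (α / γ : ℝ) * p + (β / γ : ℝ) * q := by
      have h1 : (γ : ℂ) ≠ 0 := by exact_mod_cast hγ.ne'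
      push_cast
      field_simp
      linear_combination h
    rw [eq_pt_of_opposite (one_div_pos.2 hγ) (by field_simp; linarith) h'] at he
    have := (pt_inj hd he).2
    have h3 : y = 0 := by
      have : y = -(y' * γ) := by
        rw [this]
        field_simp
      nlinarith [mul_nonneg hy' hγ.le]
    subst h3
    exact mem_segment_iff_pt.2 ⟨x, hx, by linarith, rfl⟩
  · rw [← convexHull_pair]
    refine Set.subset_inter (convexHull_mono ?_) (convexHull_mono ?_) <;>
      · intro; simp; tauto

/-- The vertices of a nondegenerate triangle are its extreme points. -/
theorem extremePoints_convexHull_triple {p q r : ℂ} (hd : (triFrame p q r).det ≠ 0) :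
    (convexHull ℝ {p, q, r}).extremePoints ℝ = {p, q, r} := by
  have key : ∀ {p q r : ℂ}, (triFrame p q r).det ≠ 0 →
      p ∈ (convexHull ℝ {p, q, r}).extremePoints ℝ := by
    intro p q r hd
    refine mem_extremePoints.2 ⟨subset_convexHull _ _ (by simp), fun z hz w hw hp => ?_⟩
    obtain ⟨x, y, hx, hy, hxy, rfl⟩ := mem_convexHull_triple.1 hz
    obtain ⟨x', y', hx', hy', hxy', rfl⟩ := mem_convexHull_triple.1 hw
    obtain ⟨a, b, ha, hb, hab, he⟩ := hp
    have : (triFrame p q r).pt (a * x + b * x') (a * y + b * y') = (triFrame p q r).pt 0 0 := by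
      have h0 : (triFrame p q r).pt 0 0 = p := by simp [triFrame, pt]
      refine .trans ?_ (he.trans h0.symm)
      have : (a : ℂ) + b = 1 := by exact_mod_cast hab
      simp only [triFrame, pt, Complex.real_smul]
      push_cast
      linear_combination -p * this
    obtain ⟨h1, h2⟩ := pt_inj hd this
    have z1 : x = 0 := by nlinarith [mul_nonneg ha.le hx, mul_nonneg hb.le hx']
    have z2 : x' = 0 := by nlinarith [mul_nonneg ha.le hx, mul_nonneg hb.le hx']
    have z3 : y = 0 := by nlinarith [mul_nonneg ha.le hy, mul_nonneg hb.le hy']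
    have z4 : y' = 0 := by nlinarith [mul_nonneg ha.le hy, mul_nonneg hb.le hy']
    subst z1 z2 z3 z4
    simp [triFrame, pt]
  apply subset_antisymm extremePoints_convexHull_subset
  rintro z (rfl | rfl | rfl)
  · exact key hd
  · rw [show ({p, z, r} : Set ℂ) = {z, r, p} by ext; simp; tauto]
    apply key
    convert hd using 1
    simp [triFrame, det]
    ring
  · rw [show ({p, q, z} : Set ℂ) = {z, p, q} by ext; simp; tauto]
    apply key
    convert hd using 1
    simp [triFrame, det]
    ring

/-! ### Robinson triangles as tiles placed at frames -/

theorem base_halfKite : RobinsonKind.base .halfKite = 1 := rfl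

theorem base_halfDart : RobinsonKind.base .halfDart = tau := rfl

theorem ofReal_tau_ne : (tau : ℂ) ≠ 0 := by exact_mod_cast tau_pos.ne'

theorem dist_sq (z w : ℂ) : dist z w ^ 2 = (z.re - w.re) ^ 2 + (z.im - w.im) ^ 2 := by
  rw [Complex.dist_eq_re_im, Real.sq_sqrt (by positivity)]

theorem dist_eq_of_sq {z w : ℂ} {d : ℝ} (hd : 0 ≤ d)
    (h : (z.re - w.re) ^ 2 + (z.im - w.im) ^ 2 = d ^ 2) : dist z w = d := by
  rw [Complex.dist_eq_re_im, h, Real.sqrt_sq hd]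

namespace RobinsonTriangle

/-- The frame at which a Robinson triangle is placed. -/
noncomputable def frame (t : RobinsonTriangle) : Frame :=
  match t.kind with
  | .halfKite => ⟨t.a, (t.b - t.a) / tau, (t.c - t.a) / tau⟩
  | .halfDart => ⟨t.b, (t.c - t.b) / tau, t.a - t.b⟩

/-- The half-kite placed at a frame. -/
@[simps] noncomputable def kite (F : Frame) (h : F.Valid) : RobinsonTriangle where
  kind := .halfKite
  a := F.o
  b := F.o + tau * F.e
  c := F.o + tau * F.f
  dist_ab := dist_eq_of_sq tau_pos.le (by
    simp [leg_halfKite]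
    linear_combination tau ^ 2 * h.1)
  dist_ac := dist_eq_of_sq tau_pos.le (by
    simp [leg_halfKite]
    linear_combination tau ^ 2 * h.2.1)
  dist_bc := dist_eq_of_sq zero_le_one (by
    obtain ⟨h1, h2, h3⟩ := h
    have := tau_sq
    simp [RobinsonKind.base]
    grind)

/-- The half-dart placed at a frame. -/
@[simps] noncomputable def dart (F : Frame) (h : F.Valid) : RobinsonTriangle where
  kind := .halfDart
  a := F.o + F.f
  b := F.o
  c := F.o + tau * F.e
  dist_ab := dist_eq_of_sq zero_le_one (by
    simp [leg_halfDart]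
    linear_combination h.2.1)
  dist_ac := dist_eq_of_sq zero_le_one (by
    obtain ⟨h1, h2, h3⟩ := h
    have := tau_sq
    simp [leg_halfDart]
    grind)
  dist_bc := dist_eq_of_sq tau_pos.le (by
    simp only [base_halfDart]
    simp
    linear_combination tau ^ 2 * h.1)

theorem frame_kite {F : Frame} (h : F.Valid) : (kite F h).frame = F := by
  have := ofReal_tau_ne
  ext <;> simp [frame] <;> field_simp

theorem frame_dart {F : Frame} (h : F.Valid) : (dart F h).frame = F := by
  have := ofReal_tau_ne
  ext <;> simp [frame] <;> field_simp

/-- The Robinson triangle of the given kind placed at a frame. -/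
noncomputable def ofFrame (k : RobinsonKind) (F : Frame) (h : F.Valid) : RobinsonTriangle :=
  match k with
  | .halfKite => kite F h
  | .halfDart => dart F h

variable {k : RobinsonKind} {F : Frame}

theorem kind_ofFrame (h : F.Valid) : (ofFrame k F h).kind = k := by
  cases k <;> rfl

theorem frame_ofFrame (h : F.Valid) : (ofFrame k F h).frame = F := by
  cases k
  · exact frame_kite h
  · exact frame_dart h

theorem frame_valid (t : RobinsonTriangle) : t.frame.Valid := by
  have ht := tau_pos
  have hr : ∀ z : ℂ, (z / tau).re = z.re / tau := fun z => Complex.div_ofReal_re z tau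
  have hi : ∀ z : ℂ, (z / tau).im = z.im / tau := fun z => Complex.div_ofReal_im z tau
  have h0 := tau_sq
  obtain ⟨k, a, b, c, h1, h2, h3⟩ := t
  replace h1 := congrArg (· ^ 2) h1
  replace h2 := congrArg (· ^ 2) h2
  replace h3 := congrArg (· ^ 2) h3
  simp only [dist_sq] at h1 h2 h3
  cases k
  · change _ = tau ^ 2 at h1
    change _ = tau ^ 2 at h2
    change _ = 1 ^ 2 at h3
    refine ⟨?_, ?_, ?_⟩
    · simp only [frame, hr, hi, Complex.sub_re, Complex.sub_im]
      field_simp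
      linarith
    · simp only [frame, hr, hi, Complex.sub_re, Complex.sub_im]
      field_simp
      linarith
    · simp only [frame, hr, hi, Complex.sub_re, Complex.sub_im]
      field_simp
      have : tau ^ 3 = 2 * tau + 1 := by linear_combination (tau + 1) * h0
      rw [this]
      linarith
  · change _ = 1 ^ 2 at h1
    change _ = 1 ^ 2 at h2
    change _ = tau ^ 2 at h3
    refine ⟨?_, ?_, ?_⟩
    · simp only [frame, hr, hi, Complex.sub_re, Complex.sub_im]
      field_simp
      linarith
    · simp only [frame, Complex.sub_re, Complex.sub_im]
      linarith
    · simp only [frame, hr, hi, Complex.sub_re, Complex.sub_im]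
      field_simp
      linarith

theorem eq_ofFrame (t : RobinsonTriangle) : t = ofFrame t.kind t.frame t.frame_valid := by
  have := ofReal_tau_ne
  obtain ⟨k, a, b, c, h1, h2, h3⟩ := t
  cases k
  · simp [ofFrame, kite, frame]
    constructor <;> field_simp <;> ring
  · simp [ofFrame, dart, frame]
    field_simp
    ring

theorem eq_of_frame_eq {s t : RobinsonTriangle} (h1 : s.kind = t.kind) (h2 : s.frame = t.frame) :
    s = t := by
  rw [s.eq_ofFrame, t.eq_ofFrame]
  congr 1

theorem region_ofFrame (h : F.Valid) : (ofFrame k F h).region = Frame.region k F := by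
  have ht := tau_pos
  have hc := ofReal_tau_ne
  ext z
  cases k
  · simp only [region, vertices, ofFrame, kite, mem_convexHull_triple, triFrame_pt]
    constructor
    · rintro ⟨x, y, hx, hy, hxy, rfl⟩
      refine ⟨tau * x, tau * y, by positivity, by positivity, ?_, ?_⟩
      · rw [leg_halfKite]
        nlinarith [mul_pos ht ht]
      · simp [pt]
        ring
    · rintro ⟨x, y, hx, hy, hxy, rfl⟩
      refine ⟨x / tau, y / tau, by positivity, by positivity, ?_, ?_⟩
      · rw [leg_halfKite] at hxy
        rw [← add_div, div_le_one ht]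
        nlinarith
      · simp [pt]
        field_simp
        ring
  · simp only [region, vertices, ofFrame, dart, mem_convexHull_triple, triFrame_pt]
    constructor
    · rintro ⟨x, y, hx, hy, hxy, rfl⟩
      refine ⟨tau * y, 1 - x - y, by positivity, by linarith, ?_, ?_⟩
      · rw [leg_halfDart]
        nlinarith
      · simp [pt]
        ring
    · rintro ⟨x, y, hx, hy, hxy, rfl⟩
      rw [leg_halfDart] at hxy
      refine ⟨1 - x / tau - y, x / tau, ?_, by positivity, by linarith, ?_⟩
      · have : x / tau ≤ 1 - y := by
          rw [div_le_iff₀ ht]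
          linarith
        linarith
      · simp [pt]
        field_simp
        ring

theorem region_eq (t : RobinsonTriangle) : t.region = Frame.region t.kind t.frame := by
  conv_lhs => rw [t.eq_ofFrame]
  exact region_ofFrame _

theorem interior_region (t : RobinsonTriangle) : interior t.region = cell t.kind t.frame := by
  rw [region_eq, t.frame_valid.interior_region]

theorem det_triFrame_ne (t : RobinsonTriangle) : (triFrame t.a t.b t.c).det ≠ 0 := by
  have h := t.frame_valid.det_ne
  have ht := tau_pos.ne'
  rw [t.eq_ofFrame]
  cases t.kind
  · have : (triFrame (kite t.frame t.frame_valid).a (kite t.frame t.frame_valid).b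
      (kite t.frame t.frame_valid).c).det = tau ^ 2 * t.frame.det := by
      simp [triFrame, det]
      ring
    simp only [ofFrame, this]
    positivity
  · have : (triFrame (dart t.frame t.frame_valid).a (dart t.frame t.frame_valid).b
      (dart t.frame t.frame_valid).c).det = tau * t.frame.det := by
      simp [triFrame, det]
      ring
    simp only [ofFrame, this]
    positivity

end RobinsonTriangle

theorem det_triFrame_swap (p q r : ℂ) : (triFrame q p r).det = -(triFrame p q r).det := by
  simp [triFrame, det]
  ring

theorem det_triFrame_swap' (p q r : ℂ) : (triFrame p r q).det = -(triFrame p q r).det := by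
  simp [triFrame, det]
  ring

/-- A point of a triangle is an interior point, a vertex, or inside a side. -/
theorem mem_convexHull_triple_cases {p q r z : ℂ} (hd : (triFrame p q r).det ≠ 0)
    (hz : z ∈ convexHull ℝ {p, q, r}) : z ∈ interior (convexHull ℝ {p, q, r}) ∨
      z ∈ ({p, q, r} : Set ℂ) ∨ z ∈ openSegment ℝ p q ∨ z ∈ openSegment ℝ p r ∨
      z ∈ openSegment ℝ q r := by
  obtain ⟨x, y, hx, hy, hxy, rfl⟩ := mem_convexHull_triple.1 hz
  have hp : (triFrame p q r).pt 0 0 = p := by simp [triFrame, pt]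
  have hq : (triFrame p q r).pt 1 0 = q := by simp [triFrame, pt]
  have hr : (triFrame p q r).pt 0 1 = r := by simp [triFrame, pt]
  obtain rfl | hx := hx.eq_or_lt
  · obtain rfl | hy := hy.eq_or_lt
    · simp [hp]
    obtain rfl | h1 := (by linarith : y ≤ 1).eq_or_lt
    · simp [hr]
    · refine .inr (.inr (.inr (.inl ?_)))
      rw [openSegment_eq_image]
      refine ⟨y, ⟨hy, h1⟩, ?_⟩
      rw [triFrame_pt]
      simp
  obtain rfl | hy := hy.eq_or_lt
  · obtain rfl | h1 := (by linarith : x ≤ 1).eq_or_lt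
    · simp [hq]
    · exact .inr (.inr (.inl (mem_openSegment_iff_pt.2 ⟨x, hx, h1, rfl⟩)))
  obtain h1 | h1 := hxy.eq_or_lt
  · refine .inr (.inr (.inr (.inr ?_)))
    rw [openSegment_eq_image]
    refine ⟨y, ⟨hy, by linarith⟩, ?_⟩
    rw [triFrame_pt]
    obtain rfl : x = 1 - y := by linarith
    simp
  · left
    have hcx := (triFrame p q r).continuous_cx
    have hcy := (triFrame p q r).continuous_cy
    refine mem_interior.2 ⟨{w | 0 < (triFrame p q r).cx w ∧ 0 < (triFrame p q r).cy w ∧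
      (triFrame p q r).cx w + (triFrame p q r).cy w < 1}, ?_, ?_, ?_⟩
    · rintro w ⟨h1, h2, h3⟩
      exact mem_convexHull_triple.2 ⟨_, _, h1.le, h2.le, h3.le, (pt_cx_cy hd w).symm⟩
    · exact (isOpen_lt continuous_const hcx).inter ((isOpen_lt continuous_const hcy).inter
        (isOpen_lt (hcx.add hcy) continuous_const))
    · simp [Frame.cx_pt hd, Frame.cy_pt hd, hx, hy, h1]

namespace RobinsonTriangle

/-- The vertex opposite to a side. -/
theorem exists_third (t : RobinsonTriangle) {e : ArrowedSide} (he : e ∈ t.sides) :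
    ∃ r, t.vertices = {e.tail, e.head, r} ∧ (triFrame e.tail e.head r).det ≠ 0 ∧
      ∀ e' ∈ t.sides, e' = e ∨ e'.seg = segment ℝ e.tail r ∨ e'.seg = segment ℝ e.head r := by
  have h := t.det_triFrame_ne
  obtain ⟨k, a, b, c, h1, h2, h3⟩ := t
  simp only [sides, Set.mem_insert_iff, Set.mem_singleton_iff, vertices, forall_eq_or_imp,
    forall_eq] at he h ⊢
  cases k <;> simp only [singleSide] at he ⊢ <;> obtain rfl | rfl | rfl := he
  · refine ⟨c, by ext; simp; tauto, by rwa [det_triFrame_swap, neg_ne_zero], .inl rfl, ?_, ?_⟩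
    · simp [ArrowedSide.seg]
    · simp [ArrowedSide.seg, segment_symm ℝ c b]
  · refine ⟨b, by ext; simp; tauto, by rwa [det_triFrame_swap', neg_ne_zero], ?_, .inl rfl, ?_⟩
    · simp [ArrowedSide.seg, segment_symm ℝ b a]
    · simp [ArrowedSide.seg]
  · refine ⟨a, by ext; simp; tauto, ?_, ?_, ?_, .inl rfl⟩
    · rwa [det_triFrame_swap, det_triFrame_swap', det_triFrame_swap, neg_neg, neg_ne_zero]
    · simp [ArrowedSide.seg]
    · simp [ArrowedSide.seg, segment_symm ℝ c a]
  · refine ⟨c, by ext; simp, h, .inl rfl, ?_, ?_⟩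
    · simp [ArrowedSide.seg]
    · simp [ArrowedSide.seg, segment_symm ℝ c b]
  · refine ⟨b, by ext; simp; tauto, by rwa [det_triFrame_swap', neg_ne_zero], ?_, .inl rfl, ?_⟩
    · simp [ArrowedSide.seg]
    · simp [ArrowedSide.seg]
  · refine ⟨a, by ext; simp; tauto, ?_, ?_, ?_, .inl rfl⟩
    · rwa [det_triFrame_swap, det_triFrame_swap', det_triFrame_swap, neg_neg, neg_ne_zero]
    · simp [ArrowedSide.seg, segment_symm ℝ a b]
    · simp [ArrowedSide.seg, segment_symm ℝ c a]

theorem seg_subset_region (t : RobinsonTriangle) {e : ArrowedSide} (he : e ∈ t.sides) :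
    e.seg ⊆ t.region := by
  obtain ⟨r, hv, -⟩ := t.exists_third he
  rw [ArrowedSide.seg, region, ← convexHull_pair, hv]
  apply convexHull_mono
  intro
  simp
  tauto

/-- A point inside one side is neither on another side nor a vertex. -/
theorem eq_of_mem_openSegment (t : RobinsonTriangle) {e e' : ArrowedSide} (he : e ∈ t.sides)
    (he' : e' ∈ t.sides) {z : ℂ} (hz : z ∈ openSegment ℝ e.tail e.head) (hz' : z ∈ e'.seg) :
    e' = e := by
  obtain ⟨r, -, hd, h⟩ := t.exists_third he
  have := notMem_segment_of_mem_openSegment hd hz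
  obtain h | h | h := h e' he'
  · exact h
  · exact (this.1 (h ▸ hz')).elim
  · exact (this.2 (h ▸ hz')).elim

theorem notMem_vertices_of_mem_openSegment (t : RobinsonTriangle) {e : ArrowedSide}
    (he : e ∈ t.sides) {z : ℂ} (hz : z ∈ openSegment ℝ e.tail e.head) : z ∉ t.vertices := by
  obtain ⟨r, hv, hd, -⟩ := t.exists_third he
  have := notMem_segment_of_mem_openSegment hd hz
  rw [hv]
  rintro (rfl | rfl | rfl)
  · exact this.1 (left_mem_segment _ _ _)
  · exact this.2 (left_mem_segment _ _ _)
  · exact this.1 (right_mem_segment _ _ _)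

theorem notMem_cell_of_mem_openSegment (t : RobinsonTriangle) {e : ArrowedSide}
    (he : e ∈ t.sides) {z : ℂ} (hz : z ∈ openSegment ℝ e.tail e.head) :
    z ∉ interior t.region := by
  obtain ⟨r, hv, hd, -⟩ := t.exists_third he
  obtain ⟨s, h0, h1, rfl⟩ := mem_openSegment_iff_pt (r := r).1 hz
  intro hz
  have hc : Filter.Tendsto (fun y : ℝ => (triFrame e.tail e.head r).pt s y)
      (nhdsWithin 0 (Set.Iio 0)) (nhds ((triFrame e.tail e.head r).pt s 0)) := by
    have : Continuous (fun y : ℝ => (triFrame e.tail e.head r).pt s y) := by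
      unfold pt
      fun_prop
    exact (this.tendsto 0).mono_left nhdsWithin_le_nhds
  obtain ⟨y, hy, h0⟩ := ((hc.eventually (mem_interior_iff_mem_nhds.1 hz)).and
    self_mem_nhdsWithin).exists
  replace h0 : y < 0 := h0
  replace hy : (triFrame e.tail e.head r).pt s y ∈ t.region := hy
  rw [region, hv] at hy
  obtain ⟨x', y', hx, hy, hxy, he⟩ := mem_convexHull_triple.1 hy
  linarith [(pt_inj hd he).2]

theorem vertices_eq_extremePoints (t : RobinsonTriangle) :
    t.vertices = t.region.extremePoints ℝ :=
  (extremePoints_convexHull_triple t.det_triFrame_ne).symm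

/-- A point of a Robinson triangle is an interior point, a vertex, or inside a side. -/
theorem mem_region_cases (t : RobinsonTriangle) {z : ℂ} (hz : z ∈ t.region) :
    z ∈ interior t.region ∨ z ∈ t.vertices ∨
      ∃ e ∈ t.sides, z ∈ openSegment ℝ e.tail e.head := by
  refine (mem_convexHull_triple_cases t.det_triFrame_ne hz).imp_right (.imp_right ?_)
  rintro (h | h | h)
  · refine ⟨t.singleSide, by simp [sides], ?_⟩
    rw [singleSide]
    cases t.kind
    · rwa [openSegment_symm]
    · exact h
  · exact ⟨⟨t.a, t.c, .double⟩, by simp [sides], h⟩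
  · exact ⟨⟨t.c, t.b, .double⟩, by simp [sides], by rwa [openSegment_symm]⟩

end RobinsonTriangle

/-! ### Local finiteness of packings -/

theorem Frame.Valid.norm_pt_sub_le {F : Frame} (h : F.Valid) {k : RobinsonKind} {z : ℂ}
    (hz : z ∈ region k F) : ‖z - F.o‖ ≤ 4 := by
  have t2 := tau_lt
  have t1 := tau_gt
  obtain ⟨x, y, hx, hy, hxy, rfl⟩ := hz
  have hx4 : x ≤ 2 ∧ y ≤ 2 := by
    cases k
    · rw [leg_halfKite] at hxy
      constructor <;> nlinarith
    · rw [leg_halfDart] at hxy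
      constructor <;> nlinarith
  have he : ‖F.e‖ = 1 := by
    rw [← sq_eq_sq₀ (norm_nonneg _) zero_le_one, Complex.sq_norm, Complex.normSq_apply]
    linarith [h.1]
  have hf : ‖F.f‖ = 1 := by
    rw [← sq_eq_sq₀ (norm_nonneg _) zero_le_one, Complex.sq_norm, Complex.normSq_apply]
    linarith [h.2.1]
  calc ‖F.pt x y - F.o‖ = ‖x * F.e + y * F.f‖ := by simp only [pt]; ring_nf
    _ ≤ ‖x * F.e‖ + ‖y * F.f‖ := norm_add_le _ _
    _ = x + y := by
      rw [norm_mul, norm_mul, he, hf, Complex.norm_real, Complex.norm_real,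
        Real.norm_of_nonneg hx, Real.norm_of_nonneg hy, mul_one, mul_one]
    _ ≤ 4 := by linarith

namespace Packing

variable {P : RobinsonKind → Frame → Prop}

theorem pairwise_disjoint_cell (hP : Packing P) :
    Pairwise (Function.onFun Disjoint
      fun p : {p : RobinsonKind × Frame // P p.1 p.2} => cell p.1.1 p.1.2) := by
  rintro ⟨⟨k, F⟩, hF⟩ ⟨⟨l, G⟩, hG⟩ hne
  rw [Function.onFun, Set.disjoint_iff_inter_eq_empty, ← Set.not_nonempty_iff_eq_empty]
  intro h
  obtain ⟨rfl, rfl⟩ := hP.disjoint hF hG h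
  exact hne rfl

theorem countable_tiles (hP : Packing P) : Countable {p : RobinsonKind × Frame // P p.1 p.2} :=
  hP.pairwise_disjoint_cell.countable_of_isOpen_disjoint (fun p => (hP.valid p.2).isOpen_cell)
    fun _ => ⟨_, centroid_mem_cell⟩

/-- A family of tiles with disjoint interiors is locally finite. -/
theorem locallyFinite_region (hP : Packing P) :
    LocallyFinite fun p : {p : RobinsonKind × Frame // P p.1 p.2} => region p.1.1 p.1.2 := by
  intro m
  refine ⟨Metric.ball m 1, Metric.ball_mem_nhds _ one_pos, ?_⟩
  set As : {p : RobinsonKind × Frame // P p.1 p.2} → Set ℂ :=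
    fun p => cell p.1.1 p.1.2 ∩ Metric.ball m 20
  -- Each tile that meets the unit ball around m contains a disc of radius 0.04 inside the ball of
  -- radius 20, since 0.04 + 4 + 4 + 1 < 20. The interiors are disjoint and the large ball has
  -- finite area.
  have hε : 0 < MeasureTheory.volume (Metric.ball (0 : ℂ) 0.04) :=
    Metric.measure_ball_pos _ _ (by norm_num)
  refine (MeasureTheory.Measure.finite_const_le_meas_of_disjoint_iUnion MeasureTheory.volume
    (As := As) hε ?_ ?_ ?_).subset ?_
  · exact fun p => (((hP.valid p.2).isOpen_cell).inter Metric.isOpen_ball).measurableSet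
  · intro p q hpq
    exact ((hP.pairwise_disjoint_cell hpq).inter_left _).inter_right _
  · refine ((MeasureTheory.measure_mono (Set.iUnion_subset fun p => Set.inter_subset_right)).trans_lt
      (Metric.isBounded_ball (x := m) (r := 20)).measure_lt_top).ne
  · rintro ⟨⟨k, F⟩, hF⟩ ⟨z, hz, hzm⟩
    have h1 := (hP.valid hF).norm_pt_sub_le hz
    have h2 := (hP.valid hF).norm_pt_sub_le (cell_subset_region (centroid_mem_cell (k := k)))
    rw [Set.mem_ofPred_eq, ← MeasureTheory.Measure.addHaar_ball_center _ (centroid k F)]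
    refine MeasureTheory.measure_mono fun w hw => ⟨?_, ?_⟩
    · have := (hP.valid hF).centroid_add_mem_cell k (w := w - centroid k F) (by
        rwa [← dist_eq_norm])
      simpa using this
    · rw [Metric.mem_ball, dist_eq_norm] at hzm hw ⊢
      calc ‖w - m‖ = ‖(w - centroid k F) + (centroid k F - F.o) - (z - F.o) + (z - m)‖ := by
            ring_nf
        _ ≤ ‖w - centroid k F‖ + ‖centroid k F - F.o‖ + ‖z - F.o‖ + ‖z - m‖ := by
            refine (norm_add_le _ _).trans (add_le_add_left ((norm_sub_le _ _).trans
              (add_le_add_left (norm_add_le _ _) _)) _)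
        _ < 20 := by linarith

end Packing

/-! ### Penrose tilings give tile systems -/

/-- The quotient f/e has modulus 1 and real part τ/2, so it is a root of z² − τz + 1. Hence one side
of a tile leaves two frames, which the next four lemmas compute for the different sides. -/
theorem Frame.Valid.quadratic {F : Frame} (h : F.Valid) :
    F.f ^ 2 - tau * F.e * F.f + F.e ^ 2 = 0 := by
  obtain ⟨h1, h2, h3⟩ := h
  have : (tau : ℂ) = 2 * (F.e.re * F.f.re + F.e.im * F.f.im : ℝ) := by rw [h3]; push_cast; ring
  rw [this]
  apply Complex.ext
  · simp [pow_two]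
    grind
  · simp [pow_two]
    grind

section

variable {F G : Frame} (hF : F.Valid) (hG : G.Valid)
include hF hG

theorem Frame.Valid.f_eq (h : G.e = F.e) : G.f = F.f ∨ G.f = tau * F.e - F.f := by
  have q1 := hF.quadratic
  have q2 := hG.quadratic
  rw [h] at q2
  have : (G.f - F.f) * (G.f - (tau * F.e - F.f)) = 0 := by linear_combination q2 - q1
  simpa [sub_eq_zero] using this

theorem Frame.Valid.e_eq (h : G.f = F.f) : G.e = F.e ∨ G.e = tau * F.f - F.e := by
  have q1 := hF.quadratic
  have q2 := hG.quadratic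
  rw [h] at q2
  have : (G.e - F.e) * (G.e - (tau * F.f - F.e)) = 0 := by linear_combination q2 - q1
  simpa [sub_eq_zero] using this

/-- The vector f − e is the direction of the base of a half-kite; the second solution is the frame
`be`. -/
theorem Frame.Valid.e_eq_of_sub_eq (h : G.f - G.e = F.f - F.e) : G.e = F.e ∨ G.e = -F.f := by
  have q1 := hF.quadratic
  have q2 := hG.quadratic
  have h' : G.f = G.e + (F.f - F.e) := by linear_combination h
  rw [h'] at q2
  have ht : (2 - tau : ℂ) ≠ 0 := by
    have : (2 - tau : ℝ) ≠ 0 := by linarith [tau_lt]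
    exact_mod_cast this
  have : (2 - tau : ℂ) * ((G.e - F.e) * (G.e - (-F.f))) = 0 := by linear_combination q2 - q1
  simpa [sub_eq_zero, ht, add_eq_zero_iff_eq_neg] using this

/-- The vector τe − f is the short double leg of a half-dart, from apex to base; the second solution
is the frame `de`. -/
theorem Frame.Valid.e_eq_of_mul_sub_eq (h : tau * G.e - G.f = tau * F.e - F.f) :
    G.e = F.e ∨ G.e = tau * F.e - tau * F.f := by
  have q1 := hF.quadratic
  have q2 := hG.quadratic
  have ht := ofReal_tau_sq
  have h' : G.f = tau * G.e - (tau * F.e - F.f) := by linear_combination -h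
  rw [h'] at q2
  have : (G.e - F.e) * (G.e - (tau * F.e - tau * F.f)) = 0 := by grind
  simpa [sub_eq_zero] using this

end

namespace RobinsonTriangle

section

variable {s t : RobinsonTriangle}

theorem of_singleSide_mem (h : t.singleSide ∈ s.sides) :
    s.kind = t.kind ∧ s.a = t.a ∧ s.b = t.b := by
  obtain ⟨k, a, b, c, h1, h2, h3⟩ := t
  obtain ⟨k', a', b', c', g1, g2, g3⟩ := s
  have := tau_gt
  cases k <;> cases k' <;>
    simp only [sides, singleSide, Set.mem_insert_iff, Set.mem_singleton_iff, ArrowedSide.mk.injEq,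
      reduceCtorEq, and_false, or_false, and_true] at *
  · exact ⟨trivial, h.2.symm, h.1.symm⟩
  · obtain ⟨rfl, rfl⟩ := h
    rw [dist_comm] at h1
    linarith [leg_halfKite, leg_halfDart, base_halfKite, base_halfDart]
  · obtain ⟨rfl, rfl⟩ := h
    rw [dist_comm] at h1
    linarith [leg_halfKite, leg_halfDart, base_halfKite, base_halfDart]
  · exact ⟨trivial, h.1.symm, h.2.symm⟩

/-- A double side of length τ is the leg of a half-kite or the base of a half-dart; one of length 1
is the base of a half-kite or the leg of a half-dart. In this lemma and the next three, τ ≠ 1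
excludes the other cases. -/
theorem of_legDouble_mem_of_halfKite (ht : t.kind = .halfKite)
    (h : ⟨t.a, t.c, .double⟩ ∈ s.sides) :
    (s.kind = .halfKite ∧ s.a = t.a ∧ s.c = t.c) ∨
      (s.kind = .halfDart ∧ s.c = t.a ∧ s.b = t.c) := by
  obtain ⟨k, a, b, c, h1, h2, h3⟩ := t
  obtain ⟨k', a', b', c', g1, g2, g3⟩ := s
  have := tau_gt
  cases ht
  cases k' <;>
    simp only [sides, singleSide, Set.mem_insert_iff, Set.mem_singleton_iff, ArrowedSide.mk.injEq,
      reduceCtorEq, and_false, false_or, and_true] at * <;> obtain ⟨rfl, rfl⟩ | ⟨rfl, rfl⟩ := h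
  · simp
  · rw [dist_comm] at g3
    linarith [leg_halfKite, leg_halfDart, base_halfKite, base_halfDart]
  · linarith [leg_halfKite, leg_halfDart, base_halfKite, base_halfDart]
  · simp

theorem of_baseDouble_mem_of_halfKite (ht : t.kind = .halfKite)
    (h : ⟨t.c, t.b, .double⟩ ∈ s.sides) :
    (s.kind = .halfKite ∧ s.c = t.c ∧ s.b = t.b) ∨
      (s.kind = .halfDart ∧ s.a = t.c ∧ s.c = t.b) := by
  obtain ⟨k, a, b, c, h1, h2, h3⟩ := t
  obtain ⟨k', a', b', c', g1, g2, g3⟩ := s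
  have := tau_gt
  cases ht
  cases k' <;>
    simp only [sides, singleSide, Set.mem_insert_iff, Set.mem_singleton_iff, ArrowedSide.mk.injEq,
      reduceCtorEq, and_false, false_or, and_true] at * <;> obtain ⟨rfl, rfl⟩ | ⟨rfl, rfl⟩ := h
  · rw [dist_comm] at h3
    linarith [leg_halfKite, leg_halfDart, base_halfKite, base_halfDart]
  · simp
  · simp
  · linarith [leg_halfKite, leg_halfDart, base_halfKite, base_halfDart]

theorem of_legDouble_mem_of_halfDart (ht : t.kind = .halfDart)
    (h : ⟨t.a, t.c, .double⟩ ∈ s.sides) :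
    (s.kind = .halfDart ∧ s.a = t.a ∧ s.c = t.c) ∨
      (s.kind = .halfKite ∧ s.c = t.a ∧ s.b = t.c) := by
  obtain ⟨k, a, b, c, h1, h2, h3⟩ := t
  obtain ⟨k', a', b', c', g1, g2, g3⟩ := s
  have := tau_gt
  cases ht
  cases k' <;>
    simp only [sides, singleSide, Set.mem_insert_iff, Set.mem_singleton_iff, ArrowedSide.mk.injEq,
      reduceCtorEq, and_false, false_or, and_true] at * <;> obtain ⟨rfl, rfl⟩ | ⟨rfl, rfl⟩ := h
  · linarith [leg_halfKite, leg_halfDart, base_halfKite, base_halfDart]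
  · simp
  · simp
  · rw [dist_comm] at g3
    linarith [leg_halfKite, leg_halfDart, base_halfKite, base_halfDart]

theorem of_baseDouble_mem_of_halfDart (ht : t.kind = .halfDart)
    (h : ⟨t.c, t.b, .double⟩ ∈ s.sides) :
    (s.kind = .halfDart ∧ s.c = t.c ∧ s.b = t.b) ∨
      (s.kind = .halfKite ∧ s.a = t.c ∧ s.c = t.b) := by
  obtain ⟨k, a, b, c, h1, h2, h3⟩ := t
  obtain ⟨k', a', b', c', g1, g2, g3⟩ := s
  have := tau_gt
  cases ht
  cases k' <;>
    simp only [sides, singleSide, Set.mem_insert_iff, Set.mem_singleton_iff, ArrowedSide.mk.injEq,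
      reduceCtorEq, and_false, false_or, and_true] at * <;> obtain ⟨rfl, rfl⟩ | ⟨rfl, rfl⟩ := h
  · simp
  · linarith [leg_halfKite, leg_halfDart, base_halfKite, base_halfDart]
  · rw [dist_comm] at h3
    linarith [leg_halfKite, leg_halfDart, base_halfKite, base_halfDart]
  · simp

theorem a_halfKite (ht : t.kind = .halfKite) : t.a = t.frame.o := by
  simp [frame, ht]

theorem b_halfKite (ht : t.kind = .halfKite) : t.b = t.frame.o + tau * t.frame.e := by
  have := ofReal_tau_ne
  simp [frame, ht]
  field_simp
  ring

theorem c_halfKite (ht : t.kind = .halfKite) : t.c = t.frame.o + tau * t.frame.f := by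
  have := ofReal_tau_ne
  simp [frame, ht]
  field_simp
  ring

theorem a_halfDart (ht : t.kind = .halfDart) : t.a = t.frame.o + t.frame.f := by
  simp [frame, ht]

theorem b_halfDart (ht : t.kind = .halfDart) : t.b = t.frame.o := by
  simp [frame, ht]

theorem c_halfDart (ht : t.kind = .halfDart) : t.c = t.frame.o + tau * t.frame.e := by
  have := ofReal_tau_ne
  simp [frame, ht]
  field_simp
  ring

end

end RobinsonTriangle

/-- The frames of the tiles of a set of Robinson triangles. -/
def frames (T : Set RobinsonTriangle) (k : RobinsonKind) (F : Frame) : Prop :=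
  ∃ t ∈ T, t.kind = k ∧ t.frame = F

namespace IsPenroseTiling

variable {T : Set RobinsonTriangle}

theorem packing (hT : IsPenroseTiling T) : Packing (frames T) where
  valid := by
    rintro k F ⟨t, -, -, rfl⟩
    exact t.frame_valid
  disjoint := by
    rintro k l F G ⟨s, hs, rfl, rfl⟩ ⟨t, ht, rfl, rfl⟩ h
    rw [← s.interior_region, ← t.interior_region] at h
    by_contra hne
    have := hT.tiling.2.1 ⟨s, hs⟩ ⟨t, ht⟩ (by rintro ⟨⟩; exact hne ⟨rfl, rfl⟩)
    exact h.ne_empty this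

/-- By local finiteness the other tiles have a closed union. It contains the complement of `t`,
hence its closure, which is everything outside the interior of `t`. -/
theorem exists_ne_mem_region (hT : IsPenroseTiling T) {t : RobinsonTriangle} (ht : t ∈ T) {m : ℂ}
    (hm : m ∉ interior t.region) : ∃ s ∈ T, s ≠ t ∧ m ∈ s.region := by
  set I := {p : {p : RobinsonKind × Frame // frames T p.1 p.2} // p.1 ≠ (t.kind, t.frame)}
  have hf : LocallyFinite fun p : I => Frame.region p.1.1.1 p.1.1.2 :=
    hT.packing.locallyFinite_region.comp_injective Subtype.val_injective
  have hc : IsClosed (⋃ p : I, Frame.region p.1.1.1 p.1.1.2) :=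
    hf.isClosed_iUnion fun p => (hT.packing.valid p.1.2).isClosed_region
  have hsub : t.regionᶜ ⊆ ⋃ p : I, Frame.region p.1.1.1 p.1.1.2 := by
    intro z hz
    obtain ⟨⟨s, hs⟩, hzs⟩ := Set.mem_iUnion.1 (hT.tiling.2.2 ▸ Set.mem_univ z)
    refine Set.mem_iUnion.2 ⟨⟨⟨(s.kind, s.frame), s, hs, rfl, rfl⟩, fun h => ?_⟩, ?_⟩
    · obtain rfl : s = t := RobinsonTriangle.eq_of_frame_eq (congrArg Prod.fst h)
        (congrArg Prod.snd h)
      exact hz hzs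
    · change z ∈ Frame.region s.kind s.frame
      rwa [← s.region_eq]
  have : m ∈ closure t.regionᶜ := by rwa [closure_compl]
  obtain ⟨⟨⟨⟨k, F⟩, s, hs, h1, h2⟩, hne⟩, hms⟩ :=
    Set.mem_iUnion.1 (hc.closure_subset_iff.2 hsub this)
  simp only at h1 h2 hms
  subst h1 h2
  refine ⟨s, hs, ?_, by rwa [s.region_eq]⟩
  rintro rfl
  exact hne rfl

/-- The midpoint of the side lies in another tile. Being no vertex, it lies on a common side, which
must be the given one, and the arrows on it agree. -/
theorem exists_mate (hT : IsPenroseTiling T) {t : RobinsonTriangle} (ht : t ∈ T)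
    {e : ArrowedSide} (he : e ∈ t.sides) : ∃ s ∈ T, s ≠ t ∧ e ∈ s.sides := by
  have hm : midpoint ℝ e.tail e.head ∈ openSegment ℝ e.tail e.head :=
    midpoint_mem_openSegment _ _
  obtain ⟨s, hs, hne, hms⟩ :=
    hT.exists_ne_mem_region ht (t.notMem_cell_of_mem_openSegment he hm)
  have hmt : midpoint ℝ e.tail e.head ∈ t.region :=
    t.seg_subset_region he (openSegment_subset_segment _ _ _ hm)
  refine ⟨s, hs, hne, ?_⟩
  obtain h | ⟨p, hp, h⟩ | ⟨e', he', f, hf, hef, h⟩ := hT.edge_to_edge t ht s hs hne.symm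
  · exact (Set.eq_empty_iff_forall_notMem.1 h _ ⟨hmt, hms⟩).elim
  · have : midpoint ℝ e.tail e.head ∈ ({p} : Set ℂ) := h ▸ ⟨hmt, hms⟩
    rw [Set.mem_singleton_iff] at this
    exact (t.notMem_vertices_of_mem_openSegment he hm (this ▸ hp.1)).elim
  · have : midpoint ℝ e.tail e.head ∈ e'.seg := h ▸ ⟨hmt, hms⟩
    obtain rfl := t.eq_of_mem_openSegment he he' hm this
    rwa [hT.arrows_match t ht s hs hne.symm _ he' _ hf hef]

end IsPenroseTiling

namespace IsPenroseTiling

variable {T : Set RobinsonTriangle} {t : RobinsonTriangle}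

/-- For each kind, the arrowed side leaves two positions of the mate, one on either side of it. A
position on the side of `t` is `t` itself or overlaps `t`. -/
theorem hasMates_halfKite (hT : IsPenroseTiling T) (ht : t ∈ T) (hk : t.kind = .halfKite) :
    HasMates (frames T) .halfKite t.frame := by
  have h0 := ofReal_tau_ne
  have hsq := ofReal_tau_sq
  have hF : frames T .halfKite t.frame := ⟨t, ht, hk, rfl⟩
  refine ⟨?_, ?_, ?_⟩
  · obtain ⟨s, hs, hne, he⟩ := hT.exists_mate ht (e := t.singleSide) (by simp [sides])
    obtain ⟨hks, ha, hb⟩ := of_singleSide_mem he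
    rw [hk] at hks
    rw [a_halfKite hks, a_halfKite hk] at ha
    rw [b_halfKite hks, b_halfKite hk, ha, add_right_inj, mul_right_inj' h0] at hb
    obtain hf | hf := t.frame_valid.f_eq s.frame_valid hb
    · exact (hne (eq_of_frame_eq (hks.trans hk.symm) (Frame.ext ha hb hf))).elim
    · exact ⟨s, hs, hks, Frame.ext ha hb hf⟩
  · obtain ⟨s, hs, hne, he⟩ := hT.exists_mate ht (e := ⟨t.a, t.c, .double⟩) (by simp [sides])
    obtain ⟨hks, ha, hc⟩ | ⟨hks, hc, hb⟩ := of_legDouble_mem_of_halfKite hk he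
    · rw [a_halfKite hks, a_halfKite hk] at ha
      rw [c_halfKite hks, c_halfKite hk, ha, add_right_inj, mul_right_inj' h0] at hc
      obtain hf | hf := t.frame_valid.e_eq s.frame_valid hc
      · exact (hne (eq_of_frame_eq (hks.trans hk.symm) (Frame.ext ha hf hc))).elim
      · exact .inl ⟨s, hs, hks, Frame.ext ha hf hc⟩
    · right
      rw [b_halfDart hks, c_halfKite hk] at hb
      have hE : s.frame.e = t.frame.eta.e := by
        rw [c_halfDart hks, a_halfKite hk, hb] at hc
        refine mul_left_cancel₀ h0 ?_
        rw [eta_e]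
        linear_combination hc
      obtain hf | hf := t.frame_valid.eta.f_eq s.frame_valid hE
      · exact ⟨s, hs, hks, Frame.ext hb hE hf⟩
      · have h1 : frames T .halfDart t.frame.eta.mE := ⟨s, hs, hks, Frame.ext hb hE hf⟩
        refine (hT.packing.not_kite_etaInv h1 ?_).elim
        have : t.frame.eta.etaInv = t.frame := by ext <;> simp
        rwa [this]
  · obtain ⟨s, hs, hne, he⟩ := hT.exists_mate ht (e := ⟨t.c, t.b, .double⟩) (by simp [sides])
    obtain ⟨hks, hc, hb⟩ | ⟨hks, ha, hc⟩ := of_baseDouble_mem_of_halfKite hk he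
    · rw [c_halfKite hks, c_halfKite hk] at hc
      rw [b_halfKite hks, b_halfKite hk] at hb
      have hd : s.frame.f - s.frame.e = t.frame.f - t.frame.e := by
        refine mul_left_cancel₀ h0 ?_
        linear_combination hc - hb
      obtain hf | hf := t.frame_valid.e_eq_of_sub_eq s.frame_valid hd
      · refine (hne (eq_of_frame_eq (hks.trans hk.symm) (Frame.ext ?_ hf ?_))).elim
        · rw [hf] at hb
          linear_combination hb
        · rw [hf] at hd
          linear_combination hd
      · refine .inl ⟨s, hs, hks, Frame.ext ?_ hf ?_⟩
        · rw [hf] at hb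
          simp only [be_o]
          linear_combination hb
        · rw [hf] at hd
          simp only [be_f]
          linear_combination hd
    · right
      rw [a_halfDart hks, c_halfKite hk] at ha
      rw [c_halfDart hks, b_halfKite hk] at hc
      have hd : tau * s.frame.e - s.frame.f = tau * t.frame.ka.e - t.frame.ka.f := by
        simp only [ka_e, ka_f]
        linear_combination hc - ha + t.frame.f * hsq
      obtain hf | hf := t.frame_valid.ka.e_eq_of_mul_sub_eq s.frame_valid hd
      · refine ⟨s, hs, hks, Frame.ext ?_ hf ?_⟩
        · rw [hf] at hc
          simp at hc ⊢
          linear_combination hc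
        · rw [hf] at hd
          linear_combination -hd
      · have h1 : frames T .halfDart t.frame.ka.de := by
          refine ⟨s, hs, hks, Frame.ext ?_ hf ?_⟩
          · rw [hf] at hc
            simp at hc ⊢
            grind
          · rw [hf] at hd
            simp at hd ⊢
            grind
        exact (hT.packing.not_dart_de_ka hF h1).elim

theorem hasMates_halfDart (hT : IsPenroseTiling T) (ht : t ∈ T) (hk : t.kind = .halfDart) :
    HasMates (frames T) .halfDart t.frame := by
  have h0 := ofReal_tau_ne
  have hsq := ofReal_tau_sq
  have hF : frames T .halfDart t.frame := ⟨t, ht, hk, rfl⟩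
  refine ⟨?_, ?_, ?_⟩
  · obtain ⟨s, hs, hne, he⟩ := hT.exists_mate ht (e := t.singleSide) (by simp [sides])
    obtain ⟨hks, ha, hb⟩ := of_singleSide_mem he
    rw [hk] at hks
    rw [b_halfDart hks, b_halfDart hk] at hb
    rw [a_halfDart hks, a_halfDart hk, hb, add_right_inj] at ha
    obtain hf | hf := t.frame_valid.e_eq s.frame_valid ha
    · exact (hne (eq_of_frame_eq (hks.trans hk.symm) (Frame.ext hb hf ha))).elim
    · exact ⟨s, hs, hks, Frame.ext hb hf ha⟩
  · obtain ⟨s, hs, hne, he⟩ := hT.exists_mate ht (e := ⟨t.a, t.c, .double⟩) (by simp [sides])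
    obtain ⟨hks, ha, hc⟩ | ⟨hks, hc, hb⟩ := of_legDouble_mem_of_halfDart hk he
    · rw [a_halfDart hks, a_halfDart hk] at ha
      rw [c_halfDart hks, c_halfDart hk] at hc
      have hd : tau * s.frame.e - s.frame.f = tau * t.frame.e - t.frame.f := by
        linear_combination hc - ha
      obtain hf | hf := t.frame_valid.e_eq_of_mul_sub_eq s.frame_valid hd
      · refine (hne (eq_of_frame_eq (hks.trans hk.symm) (Frame.ext ?_ hf ?_))).elim
        · rw [hf] at hc
          linear_combination hc
        · rw [hf] at hd
          linear_combination -hd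
      · refine .inr ⟨s, hs, hks, Frame.ext ?_ hf ?_⟩
        · rw [hf] at hc
          simp only [de_o]
          grind
        · rw [hf] at hd
          simp only [de_f]
          grind
    · left
      rw [c_halfKite hks, a_halfDart hk] at hc
      rw [b_halfKite hks, c_halfDart hk] at hb
      have hd : s.frame.f - s.frame.e = t.frame.ka.f - t.frame.ka.e := by
        refine mul_left_cancel₀ h0 ?_
        simp only [ka_e, ka_f]
        grind
      obtain hf | hf := t.frame_valid.ka.e_eq_of_sub_eq s.frame_valid hd
      · refine ⟨s, hs, hks, Frame.ext ?_ hf ?_⟩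
        · rw [hf] at hb
          simp only [ka_e, ka_o] at hb ⊢
          grind
        · rw [hf] at hd
          linear_combination hd
      · have h1 : frames T .halfKite t.frame.ka.be := by
          refine ⟨s, hs, hks, Frame.ext ?_ hf ?_⟩
          · rw [hf] at hb
            simp only [be_o, ka_o, ka_e, ka_f] at hb ⊢
            grind
          · rw [hf] at hd
            simp only [be_f] at hd ⊢
            linear_combination hd
        exact (hT.packing.not_kite_be_ka hF h1).elim
  · obtain ⟨s, hs, hne, he⟩ := hT.exists_mate ht (e := ⟨t.c, t.b, .double⟩) (by simp [sides])
    obtain ⟨hks, hc, hb⟩ | ⟨hks, ha, hc⟩ := of_baseDouble_mem_of_halfDart hk he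
    · rw [b_halfDart hks, b_halfDart hk] at hb
      rw [c_halfDart hks, c_halfDart hk, hb, add_right_inj, mul_right_inj' h0] at hc
      obtain hf | hf := t.frame_valid.f_eq s.frame_valid hc
      · exact (hne (eq_of_frame_eq (hks.trans hk.symm) (Frame.ext hb hc hf))).elim
      · exact .inl ⟨s, hs, hks, Frame.ext hb hc hf⟩
    · right
      rw [a_halfKite hks, c_halfDart hk] at ha
      have hE : s.frame.f = t.frame.etaInv.f := by
        rw [c_halfKite hks, b_halfDart hk, ha] at hc
        refine mul_left_cancel₀ h0 ?_
        rw [etaInv_f]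
        linear_combination hc
      obtain hf | hf := t.frame_valid.etaInv.e_eq s.frame_valid hE
      · exact ⟨s, hs, hks, Frame.ext ha hf hE⟩
      · have h1 : frames T .halfKite t.frame.etaInv.mF := ⟨s, hs, hks, Frame.ext ha hf hE⟩
        refine (hT.packing.not_dart_eta h1 ?_).elim
        have : t.frame.etaInv.eta = t.frame := by ext <;> simp
        rwa [this]

/-- The tiles of a Penrose tiling form a tile system. -/
theorem tileSystem (hT : IsPenroseTiling T) : TileSystem (frames T) where
  toPacking := hT.packing
  hasMates := by
    rintro k F ⟨t, ht, hk, rfl⟩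
    cases k
    · exact hT.hasMates_halfKite ht hk
    · exact hT.hasMates_halfDart ht hk

end IsPenroseTiling

/-! ### Periods of the tiles as subsets of the plane -/

theorem Frame.region_shift (k : RobinsonKind) (F : Frame) (v : ℂ) :
    region k (F.shift v) = (fun z => z + v) '' region k F := by
  ext z
  constructor
  · rintro ⟨x, y, hx, hy, hxy, rfl⟩
    refine ⟨_, ⟨x, y, hx, hy, hxy, rfl⟩, ?_⟩
    simp [pt]
    ring
  · rintro ⟨_, ⟨x, y, hx, hy, hxy, rfl⟩, rfl⟩
    refine ⟨x, y, hx, hy, hxy, ?_⟩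
    simp [pt]
    ring

theorem Frame.Valid.shift {F : Frame} (h : F.Valid) (v : ℂ) : (F.shift v).Valid := h

namespace RobinsonTriangle

/-- A half-dart is determined by its underlying set up to the exchange of the ends of its base. -/
theorem frame_of_region_eq {s t : RobinsonTriangle} (ht : t.kind = .halfDart)
    (h : s.region = t.region) :
    s.kind = .halfDart ∧ (s.frame = t.frame ∨ s.frame = t.frame.flip) := by
  have hv : s.vertices = t.vertices := by
    rw [s.vertices_eq_extremePoints, t.vertices_eq_extremePoints, h]
  have h0 := ofReal_tau_ne
  have hv' : s.kind = .halfDart ∧ s.a = t.a ∧ (s.b = t.b ∧ s.c = t.c ∨ s.b = t.c ∧ s.c = t.b) := by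
    have h1 := tau_gt
    have ha : s.a ∈ t.vertices := hv ▸ (by simp [vertices])
    have hb : s.b ∈ t.vertices := hv ▸ (by simp [vertices])
    have hc : s.c ∈ t.vertices := hv ▸ (by simp [vertices])
    clear hv h
    obtain ⟨k, a, b, c, h1, h2, h3⟩ := t
    obtain ⟨k', a', b', c', g1, g2, g3⟩ := s
    cases ht
    simp only [vertices, Set.mem_insert_iff, Set.mem_singleton_iff] at ha hb hc ⊢
    have e1 : RobinsonKind.leg .halfDart = 1 := rfl
    have e2 : RobinsonKind.base .halfDart = tau := rfl
    have e3 : RobinsonKind.leg .halfKite = tau := rfl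
    have e4 : RobinsonKind.base .halfKite = 1 := rfl
    have c1 := dist_comm a b
    have c2 := dist_comm a c
    have c3 := dist_comm b c
    have z1 := dist_self a
    have z2 := dist_self b
    have z3 := dist_self c
    cases k' <;> obtain rfl | rfl | rfl := ha <;> obtain rfl | rfl | rfl := hb <;>
      obtain rfl | rfl | rfl := hc <;> first | (exfalso; linarith) | simp
  obtain ⟨hk, ha, ⟨hb, hc⟩ | ⟨hb, hc⟩⟩ := hv'
  · refine ⟨hk, .inl ?_⟩
    simp [frame, hk, ht, ha, hb, hc]
  · refine ⟨hk, .inr ?_⟩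
    simp only [frame, hk, ht, ha, hb, hc]
    ext <;> simp <;> field_simp <;> ring

end RobinsonTriangle

theorem exists_region_eq_of_range_eq {T : Set RobinsonTriangle} {v : ℂ}
    (h : Set.range (fun t : T => (fun z => z + v) '' t.1.region) =
      Set.range fun t : T => t.1.region) {t : RobinsonTriangle} (ht : t ∈ T) :
    (∃ s ∈ T, s.region = (fun z => z + v) '' t.region) ∧
      ∃ s ∈ T, s.region = (fun z => z + -v) '' t.region := by
  constructor
  · obtain ⟨⟨s, hs⟩, h'⟩ := h ▸ Set.mem_range_self (⟨t, ht⟩ : T)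
    exact ⟨s, hs, h'⟩
  · obtain ⟨⟨s, hs⟩, h'⟩ : t.region ∈ Set.range (fun t : T => (fun z => z + v) '' t.1.region) :=
      h ▸ Set.mem_range_self (⟨t, ht⟩ : T)
    refine ⟨s, hs, ?_⟩
    simp only at h'
    rw [← h', Set.image_image]
    simp

namespace IsPenroseTiling

variable {T : Set RobinsonTriangle} {F : Frame}

/-- If the translated half-dart had the ends of its base exchanged, a half-kite would be forced
across its new double leg. But the translate of the mirror image of the half-dart, again a
half-dart, lies there. -/
theorem dart_shift (hT : IsPenroseTiling T) {v : ℂ}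
    (h : ∀ t ∈ T, ∃ s ∈ T, s.region = (fun z => z + v) '' t.region)
    (hF : frames T .halfDart F) : frames T .halfDart (F.shift v) := by
  have key : ∀ F, frames T .halfDart F → ∃ s ∈ T, s.region = region .halfDart (F.shift v) ∧
      s.kind = .halfDart ∧ (s.frame = F.shift v ∨ s.frame = (F.shift v).flip) := by
    rintro _ ⟨t, ht, hk, rfl⟩
    obtain ⟨s, hs, hr⟩ := h t ht
    rw [t.region_eq, hk, ← region_shift] at hr
    refine ⟨s, hs, hr, ?_⟩
    have hv := t.frame_valid.shift v
    rw [← RobinsonTriangle.region_ofFrame hv] at hr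
    have := RobinsonTriangle.frame_of_region_eq (RobinsonTriangle.kind_ofFrame hv) hr
    rwa [RobinsonTriangle.frame_ofFrame] at this
  obtain ⟨s, hs, -, hk, h1 | h1⟩ := key F hF
  · exact ⟨s, hs, hk, h1⟩
  · exfalso
    have hmF := (hT.tileSystem.hasMates hF).1
    obtain ⟨s', hs', hr, hk', -⟩ := key _ hmF
    have h2 : frames T .halfKite (F.shift v).flip.ka :=
      hT.tileSystem.kite_ka ⟨s, hs, hk, h1⟩
    have h3 := congrArg interior hr
    rw [s'.interior_region, ((hT.packing.valid hmF).shift v).interior_region] at h3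
    have h4 := (F.shift v).cell_mF_inter_cell_flip_ka
    rw [show (F.shift v).mF = F.mF.shift v from rfl, ← h3] at h4
    have := (hT.packing.disjoint ⟨s', hs', rfl, rfl⟩ h2 h4).1
    rw [hk'] at this
    cases this

/-- The composed family of a Penrose tiling inherits the periods of the tiles as sets. -/
theorem hasPeriod_compose (hT : IsPenroseTiling T) {v : ℂ}
    (h : Set.range (fun t : T => (fun z => z + v) '' t.1.region) =
      Set.range fun t : T => t.1.region) :
    HasPeriod (compose (frames T)) (v / tau) := by
  have h1 : ∀ {F}, frames T .halfDart F → frames T .halfDart (F.shift v) :=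
    hT.dart_shift fun t ht => (exists_region_eq_of_range_eq h ht).1
  have h2 : ∀ {F}, frames T .halfDart F → frames T .halfDart (F.shift (-v)) :=
    hT.dart_shift fun t ht => (exists_region_eq_of_range_eq h ht).2
  have h0 := ofReal_tau_ne
  intro k F hF
  cases k
  · refine ⟨?_, ?_⟩
    · convert h1 hF.1 using 1
      ext <;> simp
      field_simp
    · convert h1 hF.2 using 1
      ext <;> simp
      field_simp
  · have e : (F.shift (v / tau)).sc.nu = F.sc.nu.shift v := by
      ext <;> simp
      field_simp
      ring
    have h3 : frames T .halfDart (F.shift (v / tau)).sc.nu := by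
      rw [e]
      exact h1 hF.1
    -- Half-kites are not known to keep their arrows under translation. The required one is obtained
    -- as the only alternative to a half-dart across the base, which the translation by −v would
    -- carry back onto `hF.2`.
    refine ⟨h3, (hT.tileSystem.dart_mE_or_kite_etaInv h3).resolve_left fun h4 => ?_⟩
    refine hT.packing.not_kite_etaInv ?_ hF.2
    convert h2 h4 using 1
    rw [e]
    ext <;> simp

/-- No Penrose tiling is periodic. -/
theorem not_isPeriodicFamily (hT : IsPenroseTiling T) :
    ¬ IsPeriodicFamily (fun t : T => t.1.region) := by
  rintro ⟨v, hv, h⟩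
  have hne : ∃ k F, frames T k F := by
    obtain ⟨⟨t, ht⟩, -⟩ := Set.mem_iUnion.1 (hT.tiling.2.2 ▸ Set.mem_univ (0 : ℂ))
    exact ⟨_, _, t, ht, rfl, rfl⟩
  have := hT.tileSystem.compose.eq_zero_of_hasPeriod (hT.tileSystem.exists_compose hne)
    (hT.hasPeriod_compose h)
  simp [tau_pos.ne', hv] at this

end IsPenroseTiling

/-! ### Inflation preserves packings and neighbours -/

/-- The family of tiles obtained by dissecting the tiles of `P` dilated by the golden ratio. -/
def inflate (P : RobinsonKind → Frame → Prop) (l : RobinsonKind) (G : Frame) : Prop :=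
  ∃ k F, P k F ∧ Child k F l G

section

variable {P Q : RobinsonKind → Frame → Prop} {k l l' : RobinsonKind} {F G G' : Frame}

theorem HasMates.mono (hPQ : ∀ k F, P k F → Q k F) (h : HasMates P k F) : HasMates Q k F := by
  cases k
  · exact ⟨hPQ _ _ h.1, h.2.1.imp (hPQ _ _) (hPQ _ _), h.2.2.imp (hPQ _ _) (hPQ _ _)⟩
  · exact ⟨hPQ _ _ h.1, h.2.1.imp (hPQ _ _) (hPQ _ _), h.2.2.imp (hPQ _ _) (hPQ _ _)⟩

theorem inflate_of_eq (h : P k F) (hc : Child k F l G) (he : G = G') : inflate P l G' :=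
  he ▸ ⟨k, F, h, hc⟩

/-- If a tile has mates in a family, then so have its children in the inflated family. -/
theorem HasMates.inflate (h : HasMates P k F) (hF : P k F) (hc : Child k F l G) :
    HasMates (inflate P) l G := by
  have ht := ofReal_tau_sq
  -- A side inside the dilated tile separates two siblings; any other side lies on a side of the
  -- dilated tile, and its mate is a child of the neighbour there.
  cases hc with
  | kite_dart =>
    obtain ⟨h1, h2, h3⟩ := h
    refine ⟨?_, .inl (inflate_of_eq hF (.kite_kite F) rfl), .inl ?_⟩
    · obtain h2 | h2 := h2
      · exact inflate_of_eq h2 (.kite_dart _) (by ext <;> simp)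
      · exact inflate_of_eq h2 (.dart_dart _) (by ext <;> simp <;> grind)
    · exact inflate_of_eq h1 (.kite_dart _) (by ext <;> simp)
  | kite_kite =>
    obtain ⟨h1, h2, h3⟩ := h
    refine ⟨inflate_of_eq hF (.kite_kite' F) rfl, .inl ?_,
      .inr (inflate_of_eq hF (.kite_dart F) (ka_ka _).symm)⟩
    obtain h2 | h2 := h2
    · exact inflate_of_eq h2 (.kite_kite _) (by ext <;> simp <;> grind)
    · exact inflate_of_eq h2 (.dart_kite _) (by ext <;> simp <;> grind)
  | kite_kite' =>
    obtain ⟨h1, h2, h3⟩ := h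
    refine ⟨inflate_of_eq hF (.kite_kite F) (mE_mE _).symm, ?_,
      .inl (inflate_of_eq h1 (.kite_kite' _) (by ext <;> simp <;> grind))⟩
    obtain h3 | h3 := h3
    · exact .inl (inflate_of_eq h3 (.kite_kite' _) (by ext <;> simp <;> grind))
    · exact .inr (inflate_of_eq h3 (.dart_dart _) (by ext <;> simp <;> grind))
  | dart_dart =>
    obtain ⟨h1, h2, h3⟩ := h
    refine ⟨?_, .inl (inflate_of_eq hF (.dart_kite F) rfl), ?_⟩
    · obtain h3 | h3 := h3
      · exact inflate_of_eq h3 (.dart_dart _) (by ext <;> simp <;> grind)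
      · exact inflate_of_eq h3 (.kite_dart _) (by ext <;> simp <;> grind)
    · obtain h2 | h2 := h2
      · exact .inr (inflate_of_eq h2 (.kite_kite' _) (by ext <;> simp <;> grind))
      · exact .inl (inflate_of_eq h2 (.dart_dart _) (by ext <;> simp <;> grind))
  | dart_kite =>
    obtain ⟨h1, h2, h3⟩ := h
    refine ⟨inflate_of_eq h1 (.dart_kite _) (by ext <;> simp <;> grind), .inl ?_,
      .inr (inflate_of_eq hF (.dart_dart F) (ka_ka _).symm)⟩
    obtain h3 | h3 := h3
    · exact inflate_of_eq h3 (.dart_kite _) (by ext <;> simp <;> grind)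
    · exact inflate_of_eq h3 (.kite_kite _) (by ext <;> simp <;> grind)

/-- This lemma and the next four pass to coordinates of the undilated frame, using 1/τ = τ − 1.
Their inequalities include the cutting lines of the dissection, on opposite sides of which siblings
lie. -/
theorem mem_cell_sc {z : ℂ} (hz : z ∈ cell .halfDart F.sc) :
    ∃ x y : ℝ, 0 < x ∧ 0 < y ∧ x + y < tau ∧ x + tau * y < 1 ∧ z = tau * F.pt x y := by
  have h2 := tau_sq
  have h3 := ofReal_tau_sq
  have h1 : 0 < tau - 1 := by linarith [tau_gt]
  obtain ⟨x, y, hx, hy, hxy, rfl⟩ := hz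
  rw [leg_halfDart] at hxy
  refine ⟨(tau - 1) * x, (tau - 1) * y, by positivity, by positivity, ?_, ?_, ?_⟩
  · nlinarith
  · nlinarith
  · simp [pt]
    grind

theorem mem_cell_sc_ka {z : ℂ} (hz : z ∈ cell .halfKite F.sc.ka) :
    ∃ x y : ℝ, 0 < x ∧ 0 < y ∧ x + y < tau ∧ 1 < x + tau * y ∧ tau * x + y < tau ∧
      z = tau * F.pt x y := by
  have h2 := tau_sq
  have h3 := ofReal_tau_sq
  have h4 := tau_gt
  have h1 : 0 < tau - 1 := by linarith [tau_gt]
  obtain ⟨x, y, hx, hy, hxy, rfl⟩ := hz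
  rw [leg_halfKite] at hxy
  have hxy' : x + y < tau := by nlinarith
  refine ⟨(tau - 1) * x, tau - x - (tau - 1) * y, by positivity, ?_, ?_, ?_, ?_, ?_⟩
  · nlinarith
  · nlinarith
  · nlinarith
  · nlinarith
  · simp [pt]
    grind

theorem mem_cell_sc_ka_mE {z : ℂ} (hz : z ∈ cell .halfKite F.sc.ka.mE) :
    ∃ x y : ℝ, 0 < x ∧ 0 < y ∧ x + y < tau ∧ 1 < x + tau * y ∧ tau < tau * x + y ∧
      z = tau * F.pt x y := by
  have h2 := tau_sq
  have h3 := ofReal_tau_sq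
  have h4 := tau_gt
  have h1 : 0 < tau - 1 := by linarith [tau_gt]
  obtain ⟨x, y, hx, hy, hxy, rfl⟩ := hz
  rw [leg_halfKite] at hxy
  have hxy' : x + y < tau := by nlinarith
  refine ⟨(tau - 1) * x + y, tau - x - y, by positivity, ?_, ?_, ?_, ?_, ?_⟩
  · nlinarith
  · nlinarith
  · nlinarith
  · nlinarith
  · simp [pt]
    grind

theorem mem_cell_sc_nu {z : ℂ} (hz : z ∈ cell .halfDart F.sc.nu) :
    ∃ x y : ℝ, 0 < x ∧ 0 < y ∧ x + tau * y < tau ∧ 1 < x + y ∧ z = tau * F.pt x y := by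
  have h2 := tau_sq
  have h3 := ofReal_tau_sq
  have h4 := tau_gt
  have h1 : 0 < tau - 1 := by linarith [tau_gt]
  obtain ⟨x, y, hx, hy, hxy, rfl⟩ := hz
  rw [leg_halfDart] at hxy
  refine ⟨tau - x - (tau - 1) * y, (tau - 1) * x, ?_, by positivity, ?_, ?_, ?_⟩
  · nlinarith
  · nlinarith
  · nlinarith
  · simp [pt]
    grind

theorem mem_cell_sc_nu_ka {z : ℂ} (hz : z ∈ cell .halfKite F.sc.nu.ka) :
    ∃ x y : ℝ, 0 < x ∧ 0 < y ∧ x + tau * y < tau ∧ x + y < 1 ∧ z = tau * F.pt x y := by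
  have h2 := tau_sq
  have h3 := ofReal_tau_sq
  have h4 := tau_gt
  have h1 : 0 < tau - 1 := by linarith [tau_gt]
  obtain ⟨x, y, hx, hy, hxy, rfl⟩ := hz
  rw [leg_halfKite] at hxy
  have hxy' : x + y < tau := by nlinarith
  have e : tau * ((tau - 1) * x) = x := by linear_combination x * h2
  refine ⟨(tau - 1) * y, (tau - 1) * x, by positivity, by positivity, ?_, ?_, ?_⟩
  · nlinarith [mul_pos hy (by linarith [tau_lt] : 0 < 2 - tau)]
  · nlinarith
  · simp [pt]
    grind

/-- The children of a tile are contained in the dilated tile. -/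
theorem Child.exists_mem_cell (hc : Child k F l G) {z : ℂ} (hz : z ∈ cell l G) :
    ∃ w ∈ cell k F, z = tau * w := by
  have h0 := tau_pos
  cases hc with
  | kite_dart =>
    obtain ⟨x, y, hx, hy, h, -, rfl⟩ := mem_cell_sc hz
    exact ⟨_, ⟨x, y, hx, hy, by rw [leg_halfKite]; nlinarith, rfl⟩, rfl⟩
  | kite_kite =>
    obtain ⟨x, y, hx, hy, h, -, -, rfl⟩ := mem_cell_sc_ka hz
    exact ⟨_, ⟨x, y, hx, hy, by rw [leg_halfKite]; nlinarith, rfl⟩, rfl⟩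
  | kite_kite' =>
    obtain ⟨x, y, hx, hy, h, -, -, rfl⟩ := mem_cell_sc_ka_mE hz
    exact ⟨_, ⟨x, y, hx, hy, by rw [leg_halfKite]; nlinarith, rfl⟩, rfl⟩
  | dart_dart =>
    obtain ⟨x, y, hx, hy, h, -, rfl⟩ := mem_cell_sc_nu hz
    exact ⟨_, ⟨x, y, hx, hy, by rw [leg_halfDart]; linarith, rfl⟩, rfl⟩
  | dart_kite =>
    obtain ⟨x, y, hx, hy, h, -, rfl⟩ := mem_cell_sc_nu_ka hz
    exact ⟨_, ⟨x, y, hx, hy, by rw [leg_halfDart]; linarith, rfl⟩, rfl⟩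

/-- Distinct children of a tile have disjoint interiors. -/
theorem Child.eq_of_inter (hF : F.Valid) (hc : Child k F l G) (hc' : Child k F l' G')
    (h : (cell l G ∩ cell l' G').Nonempty) : l = l' ∧ G = G' := by
  have h0 : (tau : ℂ) ≠ 0 := ofReal_tau_ne
  obtain ⟨z, hz, hz'⟩ := h
  have key : ∀ {x y x' y' : ℝ}, z = tau * F.pt x y → z = tau * F.pt x' y' → x = x' ∧ y = y' :=
    fun h h' => pt_inj hF.det_ne (mul_left_cancel₀ h0 (h.symm.trans h'))
  cases hc <;> cases hc'
  · simp
  · obtain ⟨x, y, hx, hy, h1, h2, h3⟩ := mem_cell_sc hz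
    obtain ⟨x', y', hx', hy', h1', h2', h4', h3'⟩ := mem_cell_sc_ka hz'
    obtain ⟨rfl, rfl⟩ := key h3 h3'
    linarith
  · obtain ⟨x, y, hx, hy, h1, h2, h3⟩ := mem_cell_sc hz
    obtain ⟨x', y', hx', hy', h1', h2', h4', h3'⟩ := mem_cell_sc_ka_mE hz'
    obtain ⟨rfl, rfl⟩ := key h3 h3'
    linarith
  · obtain ⟨x, y, hx, hy, h1, h2, h3⟩ := mem_cell_sc hz'
    obtain ⟨x', y', hx', hy', h1', h2', h4', h3'⟩ := mem_cell_sc_ka hz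
    obtain ⟨rfl, rfl⟩ := key h3 h3'
    linarith
  · simp
  · obtain ⟨x, y, hx, hy, h1, h2, h4, h3⟩ := mem_cell_sc_ka hz
    obtain ⟨x', y', hx', hy', h1', h2', h4', h3'⟩ := mem_cell_sc_ka_mE hz'
    obtain ⟨rfl, rfl⟩ := key h3 h3'
    linarith
  · obtain ⟨x, y, hx, hy, h1, h2, h3⟩ := mem_cell_sc hz'
    obtain ⟨x', y', hx', hy', h1', h2', h4', h3'⟩ := mem_cell_sc_ka_mE hz
    obtain ⟨rfl, rfl⟩ := key h3 h3'
    linarith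
  · obtain ⟨x, y, hx, hy, h1, h2, h4, h3⟩ := mem_cell_sc_ka hz'
    obtain ⟨x', y', hx', hy', h1', h2', h4', h3'⟩ := mem_cell_sc_ka_mE hz
    obtain ⟨rfl, rfl⟩ := key h3 h3'
    linarith
  · simp
  · simp
  · obtain ⟨x, y, hx, hy, h1, h2, h3⟩ := mem_cell_sc_nu hz
    obtain ⟨x', y', hx', hy', h1', h2', h3'⟩ := mem_cell_sc_nu_ka hz'
    obtain ⟨rfl, rfl⟩ := key h3 h3'
    linarith
  · obtain ⟨x, y, hx, hy, h1, h2, h3⟩ := mem_cell_sc_nu hz'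
    obtain ⟨x', y', hx', hy', h1', h2', h3'⟩ := mem_cell_sc_nu_ka hz
    obtain ⟨rfl, rfl⟩ := key h3 h3'
    linarith
  · simp

theorem Packing.inflate (hP : Packing P) : Packing (inflate P) where
  valid := by
    rintro l G ⟨k, F, hF, hc⟩
    exact hc.valid (hP.valid hF)
  disjoint := by
    rintro l l' G G' ⟨k, F, hF, hc⟩ ⟨k', F', hF', hc'⟩ ⟨z, hz, hz'⟩
    obtain ⟨w, hw, rfl⟩ := hc.exists_mem_cell hz
    obtain ⟨w', hw', h⟩ := hc'.exists_mem_cell hz'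
    obtain rfl := mul_left_cancel₀ ofReal_tau_ne h
    obtain ⟨rfl, rfl⟩ := hP.disjoint hF hF' ⟨w, hw, hw'⟩
    exact hc.eq_of_inter (hP.valid hF) hc' ⟨_, hz, hz'⟩

end

/-! ### An increasing sequence of patches -/

/-- The family consisting of one half-kite. -/
def single (F : Frame) (k : RobinsonKind) (G : Frame) : Prop := k = .halfKite ∧ G = F

theorem packing_single {F : Frame} (hF : F.Valid) : Packing (single F) where
  valid := by
    rintro k G ⟨-, rfl⟩
    exact hF
  disjoint := by
    rintro k l G H ⟨rfl, rfl⟩ ⟨rfl, rfl⟩ -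
    simp

/-- A half-kite that is strictly inside its fourth inflation. -/
noncomputable def seed : Frame where
  -- The chain of four children used in `continues_single_seed` sends the origin o to τ⁴o + τ²(e +
  -- f) and restores e and f. This is its fixed point, as τ² − τ⁻² = 2τ − 1.
  o := -(1 + (⟨tau / 2, √(1 - tau ^ 2 / 4)⟩ : ℂ)) / (2 * tau - 1)
  e := 1
  f := ⟨tau / 2, √(1 - tau ^ 2 / 4)⟩

theorem seed_valid : seed.Valid := by
  refine ⟨by simp [seed], ?_, by simp [seed]⟩
  have : 0 ≤ 1 - tau ^ 2 / 4 := by nlinarith [tau_sq, tau_lt]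
  simp only [seed, Real.sq_sqrt this]
  ring

theorem seed_o : (2 * tau - 1) * seed.o = -(seed.e + seed.f) := by
  have : (2 * tau - 1 : ℂ) ≠ 0 := by
    have : (2 * tau - 1 : ℝ) ≠ 0 := by linarith [tau_gt]
    exact_mod_cast this
  simp only [seed]
  field_simp

/-- The family has all mates of the tiles of the first family, and contains these tiles. -/
def Continues (P Q : RobinsonKind → Frame → Prop) : Prop :=
  ∀ k F, P k F → Q k F ∧ HasMates Q k F

theorem Continues.inflate {P Q : RobinsonKind → Frame → Prop} (h : Continues P Q) :
    Continues (inflate P) (inflate Q) := by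
  rintro l G ⟨k, F, hF, hc⟩
  obtain ⟨h1, h2⟩ := h k F hF
  exact ⟨⟨k, F, h1, hc⟩, h2.inflate h1 hc⟩

/-- The seed is its own descendant in the fourth generation, by the choice of its origin. Its three
neighbours descend from the same tile `h2` of the second generation. -/
theorem continues_single_seed : Continues (single seed) (inflate^[4] (single seed)) := by
  rintro k F ⟨rfl, rfl⟩
  have ht := ofReal_tau_sq
  have ho := seed_o
  generalize seed = F at *
  have h2 : inflate (inflate (single F)) .halfKite F.sc.ka.sc.ka.mE :=
    ⟨_, _, ⟨_, _, ⟨rfl, rfl⟩, .kite_kite F⟩, .kite_kite' _⟩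
  simp only [Function.iterate_succ, Function.iterate_zero, Function.comp_apply, id]
  refine ⟨?_, ?_, .inr ?_, .inl ?_⟩
  · exact inflate_of_eq ⟨_, _, h2, .kite_kite _⟩ (.kite_kite' _) (by ext <;> simp <;> grind)
  · exact inflate_of_eq ⟨_, _, h2, .kite_kite _⟩ (.kite_kite _) (by ext <;> simp <;> grind)
  · exact inflate_of_eq ⟨_, _, h2, .kite_dart _⟩ (.dart_dart _) (by ext <;> simp <;> grind)
  · exact inflate_of_eq ⟨_, _, h2, .kite_kite' _⟩ (.kite_kite' _) (by ext <;> simp <;> grind)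

/-- The `n`-th family in the increasing sequence whose union is a Penrose tiling. -/
def patch (n : ℕ) : RobinsonKind → Frame → Prop := inflate^[4 * n] (single seed)

theorem continues_patch (n : ℕ) : Continues (patch n) (patch (n + 1)) := by
  have key : ∀ m, Continues (inflate^[m] (single seed))
      (inflate^[m] (inflate^[4] (single seed))) := by
    intro m
    induction m with
    | zero => exact continues_single_seed
    | succ m ih =>
      rw [Function.iterate_succ_apply', Function.iterate_succ_apply']
      exact ih.inflate
  have := key (4 * n)
  rwa [← Function.iterate_add_apply] at this

theorem packing_patch (n : ℕ) : Packing (patch n) := by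
  have key : ∀ m, Packing (inflate^[m] (single seed)) := by
    intro m
    induction m with
    | zero => exact packing_single seed_valid
    | succ m ih =>
      rw [Function.iterate_succ_apply']
      exact ih.inflate
  exact key _

theorem patch_mono {m n : ℕ} (h : m ≤ n) {k : RobinsonKind} {F : Frame} (hF : patch m k F) :
    patch n k F := by
  induction n, h using Nat.le_induction with
  | base => exact hF
  | succ n _ ih => exact (continues_patch n k F ih).1

/-- The tiles of a Penrose tiling. -/
def limitPatch (k : RobinsonKind) (F : Frame) : Prop := ∃ n, patch n k F

theorem tileSystem_limitPatch : TileSystem limitPatch where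
  valid := by
    rintro k F ⟨n, h⟩
    exact (packing_patch n).valid h
  disjoint := by
    rintro k l F G ⟨m, hF⟩ ⟨n, hG⟩ h
    exact (packing_patch (max m n)).disjoint (patch_mono (le_max_left _ _) hF)
      (patch_mono (le_max_right _ _) hG) h
  hasMates := by
    rintro k F ⟨n, h⟩
    exact (continues_patch n k F h).2.mono fun k F h => ⟨n + 1, h⟩

theorem limitPatch_seed : limitPatch .halfKite seed := ⟨0, rfl, rfl⟩

/-! ### Tile systems give Penrose tilings -/

/-- The triangle `s` lies on the other side of the side `e` of `t` and has the same arrow on it. -/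
def Across (t s : RobinsonTriangle) (e : ArrowedSide) : Prop :=
  e ∈ s.sides ∧ ∃ (r r' : ℂ) (α β γ : ℝ), 0 < γ ∧ α + β = 1 + γ ∧
    r' + γ * r = α * e.tail + β * e.head ∧ t.vertices = {e.tail, e.head, r} ∧
    s.vertices = {e.tail, e.head, r'}

namespace Across

variable {s t : RobinsonTriangle} {e : ArrowedSide}

theorem exists_opposite (h : Across t s e) (he : e ∈ t.sides) :
    ∃ (r r' : ℂ) (α β γ : ℝ), 0 < γ ∧ α + β = 1 + γ ∧
    r' + γ * r = α * e.tail + β * e.head ∧ t.vertices = {e.tail, e.head, r} ∧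
    s.vertices = {e.tail, e.head, r'} ∧ (triFrame e.tail e.head r).det ≠ 0 := by
  obtain ⟨-, r, r', α, β, γ, h1, h2, h3, h4, h5⟩ := h
  refine ⟨r, r', α, β, γ, h1, h2, h3, h4, h5, ?_⟩
  obtain ⟨r₁, h6, hd, -⟩ := t.exists_third he
  have : r₁ ∈ ({e.tail, e.head, r} : Set ℂ) := by rw [← h4, h6]; simp
  obtain h | h | h := this
  · simp [h, triFrame, det] at hd
  · rw [h] at hd
    exact (hd (by simp [triFrame, det]; ring)).elim
  · rwa [← h]

theorem union_mem_nhds (h : Across t s e) (he : e ∈ t.sides) {z : ℂ}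
    (hz : z ∈ openSegment ℝ e.tail e.head) : t.region ∪ s.region ∈ nhds z := by
  obtain ⟨r, r', α, β, γ, h1, h2, h3, h4, h5, hd⟩ := h.exists_opposite he
  rw [RobinsonTriangle.region, RobinsonTriangle.region, h4, h5]
  exact _root_.union_mem_nhds hd h1 h2 h3 hz

theorem inter_eq (h : Across t s e) (he : e ∈ t.sides) : t.region ∩ s.region = e.seg := by
  obtain ⟨r, r', α, β, γ, h1, h2, h3, h4, h5, hd⟩ := h.exists_opposite he
  rw [RobinsonTriangle.region, RobinsonTriangle.region, h4, h5]
  exact convexHull_inter_convexHull hd h1 h2 h3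

end Across

namespace TileSystem

variable {P : RobinsonKind → Frame → Prop}

theorem exists_across_kite (hP : TileSystem P) {F : Frame} (hF : F.Valid) (h : P .halfKite F)
    {e : ArrowedSide} (he : e ∈ (RobinsonTriangle.kite F hF).sides) :
    ∃ s : RobinsonTriangle, P s.kind s.frame ∧ Across (RobinsonTriangle.kite F hF) s e := by
  have hsq := ofReal_tau_sq
  have ht := tau_gt
  have hsq' := tau_sq
  obtain ⟨h1, h2, h3⟩ := hP.hasMates h
  have hk : ∀ {G}, P .halfKite G → (hG : G.Valid) →
      P (RobinsonTriangle.kite G hG).kind (RobinsonTriangle.kite G hG).frame := by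
    intro G hG hv
    rwa [RobinsonTriangle.frame_kite]
  have hd : ∀ {G}, P .halfDart G → (hG : G.Valid) →
      P (RobinsonTriangle.dart G hG).kind (RobinsonTriangle.dart G hG).frame := by
    intro G hG hv
    rwa [RobinsonTriangle.frame_dart]
  obtain rfl | rfl | rfl := he
  -- Here and in the other cases, the numbers supplied are the weights α, β, γ expressing the third
  -- vertex of the mate through the vertices of the tile.
  · refine ⟨_, hk h1 hF.mE, .inl ?_, F.o + tau * F.f, F.o + tau * (tau * F.e - F.f), tau, 2 - tau,
      1, by norm_num, by ring, ?_, ?_, ?_⟩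
    · simp [RobinsonTriangle.singleSide]
    · simp [RobinsonTriangle.singleSide]
      ring
    · ext
      simp [RobinsonTriangle.vertices, RobinsonTriangle.singleSide]
      tauto
    · ext
      simp [RobinsonTriangle.vertices, RobinsonTriangle.singleSide]
      tauto
  · obtain h2 | h2 := h2
    · refine ⟨_, hk h2 hF.mF, .inr (.inl ?_), F.o + tau * F.e, F.o + tau * (tau * F.f - F.e),
        2 - tau, tau, 1, by norm_num, by ring, ?_, ?_, ?_⟩
      · simp
      · simp
        ring
      · ext
        simp [RobinsonTriangle.vertices]
        tauto
      · ext
        simp [RobinsonTriangle.vertices]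
        tauto
    · refine ⟨_, hd h2 hF.eta, .inr (.inr ?_), F.o + tau * F.e, F.o + tau * F.f - F.e,
        tau - 1, 1, tau - 1, by linarith, by ring, ?_, ?_, ?_⟩
      · simp
      · simp
        grind
      · ext
        simp [RobinsonTriangle.vertices]
        tauto
      · ext
        simp [RobinsonTriangle.vertices, sub_eq_add_neg]
        tauto
  · obtain h3 | h3 := h3
    · refine ⟨_, hk h3 hF.be, .inr (.inr ?_), F.o, F.o + tau * F.e + tau * F.f,
        1, 1, 1, by norm_num, by ring, ?_, ?_, ?_⟩
      · simp
        ring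
      · simp
        ring
      · ext
        simp [RobinsonTriangle.vertices]
        tauto
      · have e1 : F.o + tau * F.e + tau * F.f + -(tau * F.e) = F.o + tau * F.f := by ring
        ext
        simp [RobinsonTriangle.vertices, e1]
        tauto
    · have e1 : F.o + tau ^ 2 * F.f + -F.f = F.o + tau * F.f := by grind
      have e2 : F.o + tau ^ 2 * F.f + tau * (F.e - tau * F.f) = F.o + tau * F.e := by ring
      refine ⟨_, hd h3 hF.ka, .inr (.inl ?_), F.o, F.o + tau ^ 2 * F.f,
        tau, 0, tau - 1, by linarith, by ring, ?_, ?_, ?_⟩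
      · simp [e1, e2]
      · simp
        ring
      · ext
        simp [RobinsonTriangle.vertices]
        tauto
      · ext
        simp [RobinsonTriangle.vertices, e1, e2]
        tauto

theorem exists_across_dart (hP : TileSystem P) {F : Frame} (hF : F.Valid) (h : P .halfDart F)
    {e : ArrowedSide} (he : e ∈ (RobinsonTriangle.dart F hF).sides) :
    ∃ s : RobinsonTriangle, P s.kind s.frame ∧ Across (RobinsonTriangle.dart F hF) s e := by
  have hsq := ofReal_tau_sq
  have ht := tau_gt
  have hsq' := tau_sq
  have h2 := hP.kite_ka h
  obtain ⟨h1, -, h3⟩ := hP.hasMates h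
  have hk : ∀ {G}, P .halfKite G → (hG : G.Valid) →
      P (RobinsonTriangle.kite G hG).kind (RobinsonTriangle.kite G hG).frame := by
    intro G hG hv
    rwa [RobinsonTriangle.frame_kite]
  have hd : ∀ {G}, P .halfDart G → (hG : G.Valid) →
      P (RobinsonTriangle.dart G hG).kind (RobinsonTriangle.dart G hG).frame := by
    intro G hG hv
    rwa [RobinsonTriangle.frame_dart]
  obtain rfl | rfl | rfl := he
  · refine ⟨_, hd h1 hF.mF, .inl ?_, F.o + tau * F.e, F.o + tau * (tau * F.f - F.e), tau ^ 2,
      2 - tau ^ 2, 1, by norm_num, by ring, ?_, ?_, ?_⟩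
    · simp [RobinsonTriangle.singleSide]
    · simp [RobinsonTriangle.singleSide]
      ring
    · simp [RobinsonTriangle.vertices, RobinsonTriangle.singleSide]
    · simp [RobinsonTriangle.vertices, RobinsonTriangle.singleSide]
  · have e1 : F.o + tau ^ 2 * F.f + -(tau * F.f) = F.o + F.f := by grind
    have e2 : F.o + tau ^ 2 * F.f + tau * (F.e - tau * F.f) = F.o + tau * F.e := by ring
    refine ⟨_, hk h2 hF.ka, .inr (.inr ?_), F.o, F.o + tau ^ 2 * F.f,
      tau ^ 2, 0, tau, by linarith, by linarith, ?_, ?_, ?_⟩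
    · simp [e1, e2]
    · simp
      grind
    · ext
      simp [RobinsonTriangle.vertices]
      tauto
    · ext
      simp [RobinsonTriangle.vertices, e1, e2]
      tauto
  · obtain h3 | h3 := h3
    · refine ⟨_, hd h3 hF.mE, .inr (.inr ?_), F.o + F.f, F.o + (tau * F.e - F.f),
        1, 1, 1, by norm_num, by ring, ?_, ?_, ?_⟩
      · simp
      · simp
        ring
      · ext
        simp [RobinsonTriangle.vertices]
        tauto
      · ext
        simp [RobinsonTriangle.vertices]
        tauto
    · refine ⟨_, hk h3 hF.etaInv, .inr (.inl ?_), F.o + F.f, F.o + tau * F.e + -(tau * F.f),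
        1, tau, tau, by linarith, by ring, ?_, ?_, ?_⟩
      · simp
      · simp
        ring
      · ext
        simp [RobinsonTriangle.vertices]
        tauto
      · ext
        simp [RobinsonTriangle.vertices]
        tauto

theorem exists_across (hP : TileSystem P) {t : RobinsonTriangle} (h : P t.kind t.frame)
    {e : ArrowedSide} (he : e ∈ t.sides) :
    ∃ s : RobinsonTriangle, P s.kind s.frame ∧ Across t s e := by
  have := t.eq_ofFrame
  generalize t.kind = k at *
  generalize t.frame_valid = hv at *
  generalize t.frame = F at *
  subst this
  cases k
  · exact hP.exists_across_kite hv h he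
  · exact hP.exists_across_dart hv h he

variable {s t u : RobinsonTriangle}

theorem eq_of_interior_inter (hP : TileSystem P) (hs : P s.kind s.frame) (ht : P t.kind t.frame)
    (h : (interior s.region ∩ interior t.region).Nonempty) : s = t := by
  rw [s.interior_region, t.interior_region] at h
  obtain ⟨h1, h2⟩ := hP.disjoint hs ht h
  exact RobinsonTriangle.eq_of_frame_eq h1 h2

theorem inter_interior_nonempty {W : Set ℂ} (hW : IsOpen W) (h : (W ∩ t.region).Nonempty) :
    (W ∩ interior t.region).Nonempty := by
  rw [t.region_eq] at h
  rw [t.interior_region]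
  exact inter_cell_nonempty hW h

/-- A tile through a point inside a side of another tile is the one across that side. -/
theorem across_of_mem_openSegment (hP : TileSystem P) (ht : P t.kind t.frame)
    (hu : P u.kind u.frame) {e : ArrowedSide} (he : e ∈ t.sides) {z : ℂ}
    (hz : z ∈ openSegment ℝ e.tail e.head) (hzu : z ∈ u.region) : u = t ∨ Across t u e := by
  obtain ⟨s, hs, ha⟩ := hP.exists_across ht he
  have hW := mem_interior_iff_mem_nhds.2 (ha.union_mem_nhds he hz)
  have hO : IsOpen (interior (t.region ∪ s.region) ∩ interior u.region) :=
    isOpen_interior.inter isOpen_interior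
  obtain ⟨w, hw⟩ := inter_interior_nonempty isOpen_interior ⟨z, hW, hzu⟩
  obtain h | h := interior_subset hw.1
  · obtain ⟨y, hy, hy'⟩ := inter_interior_nonempty hO ⟨w, hw, h⟩
    exact .inl (hP.eq_of_interior_inter hu ht ⟨y, hy.2, hy'⟩)
  · obtain ⟨y, hy, hy'⟩ := inter_interior_nonempty hO ⟨w, hw, h⟩
    rw [hP.eq_of_interior_inter hu hs ⟨y, hy.2, hy'⟩]
    exact .inr ha

theorem mem_vertices_or (hP : TileSystem P) (ht : P t.kind t.frame) (hs : P s.kind s.frame)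
    (hne : s ≠ t) {z : ℂ} (hzs : z ∈ s.region) (hzt : z ∈ t.region) :
    z ∈ t.vertices ∨ ∃ e ∈ t.sides, z ∈ openSegment ℝ e.tail e.head := by
  refine (t.mem_region_cases hzt).resolve_left fun h => ?_
  obtain ⟨y, hy, hy'⟩ := inter_interior_nonempty isOpen_interior ⟨z, h, hzs⟩
  exact hne (hP.eq_of_interior_inter hs ht ⟨y, hy', hy⟩)

/-- A common point inside a side makes this side the whole intersection. Otherwise all common points
are vertices; two of them would have their midpoint in the convex intersection, hence a vertex,
although vertices are extreme points. -/
theorem edge_to_edge (hP : TileSystem P) (hs : P s.kind s.frame) (ht : P t.kind t.frame)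
    (hne : s ≠ t) : s.region ∩ t.region = ∅ ∨
      (∃ p ∈ s.vertices ∩ t.vertices, s.region ∩ t.region = {p}) ∨
      (∃ e ∈ s.sides, ∃ f ∈ t.sides, e.seg = f.seg ∧ s.region ∩ t.region = e.seg) := by
  by_cases h : ∃ z ∈ s.region ∩ t.region, ∃ e ∈ s.sides, z ∈ openSegment ℝ e.tail e.head
  · obtain ⟨z, ⟨hzs, hzt⟩, e, he, hz⟩ := h
    have ha := (hP.across_of_mem_openSegment hs ht he hz hzt).resolve_left hne.symm
    exact .inr (.inr ⟨e, he, e, ha.1, rfl, ha.inter_eq he⟩)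
  push Not at h
  have hvs : ∀ z ∈ s.region ∩ t.region, z ∈ s.vertices := fun z hz =>
    (hP.mem_vertices_or hs ht hne.symm hz.2 hz.1).resolve_right fun ⟨e, he, hze⟩ => h z hz e he hze
  have hvt : ∀ z ∈ s.region ∩ t.region, z ∈ t.vertices := by
    refine fun z hz => (hP.mem_vertices_or ht hs hne hz.1 hz.2).resolve_right ?_
    rintro ⟨e, he, hze⟩
    have ha := (hP.across_of_mem_openSegment ht hs he hze hz.1).resolve_left hne
    exact h z hz e ha.1 hze
  obtain h0 | ⟨p, hp⟩ := (s.region ∩ t.region).eq_empty_or_nonempty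
  · exact .inl h0
  refine .inr (.inl ⟨p, ⟨hvs p hp, hvt p hp⟩, subset_antisymm (fun q hq => ?_) (by simpa using hp)⟩)
  have hc : Convex ℝ (s.region ∩ t.region) := (convex_convexHull _ _).inter (convex_convexHull _ _)
  have hm : midpoint ℝ p q ∈ s.vertices := hvs _ (hc.midpoint_mem hp hq)
  rw [s.vertices_eq_extremePoints, mem_extremePoints] at hm
  have := hm.2 p hp.1 q hq.1 (midpoint_mem_openSegment p q)
  rw [Set.mem_singleton_iff, this.1]
  exact this.2

/-- The tiles of a nonempty tile system cover the plane. -/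
theorem iUnion_region (hP : TileSystem P) (hne : ∃ k F, P k F) :
    (⋃ p : {p : RobinsonKind × Frame // P p.1 p.2}, region p.1.1 p.1.2) = Set.univ := by
  set U := ⋃ p : {p : RobinsonKind × Frame // P p.1 p.2}, region p.1.1 p.1.2 with hU
  have hUc : IsClosed U :=
    hP.locallyFinite_region.isClosed_iUnion fun p => (hP.valid p.2).isClosed_region
  have hmem : ∀ t : RobinsonTriangle, P t.kind t.frame → t.region ⊆ U := by
    intro t ht
    rw [t.region_eq]
    exact Set.subset_iUnion (fun p : {p : RobinsonKind × Frame // P p.1 p.2} =>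
      region p.1.1 p.1.2) ⟨(t.kind, t.frame), ht⟩
  have : Countable {p : RobinsonKind × Frame // P p.1 p.2} := hP.countable_tiles
  set V := ⋃ p : {p : RobinsonKind × Frame // P p.1 p.2},
    (RobinsonTriangle.ofFrame p.1.1 p.1.2 (hP.valid p.2)).vertices with hV
  have hVc : V.Countable := Set.countable_iUnion fun p => by
    simp [RobinsonTriangle.vertices, Set.countable_singleton]
  -- A covered point that is no vertex is inside a tile, or inside a side, where the tile and its
  -- mate fill a neighbourhood. Thus `U` is open and closed relative to the connected set `Vᶜ`.
  have hcov : Vᶜ ⊆ interior U ∪ Uᶜ := by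
    intro z hz
    by_cases hzU : z ∈ U
    · left
      obtain ⟨p, hp⟩ := Set.mem_iUnion.1 hzU
      set t := RobinsonTriangle.ofFrame p.1.1 p.1.2 (hP.valid p.2) with htdef
      have hk : t.kind = p.1.1 := RobinsonTriangle.kind_ofFrame _
      have hf : t.frame = p.1.2 := RobinsonTriangle.frame_ofFrame _
      have ht : P t.kind t.frame := by
        rw [hk, hf]
        exact p.2
      have hzt : z ∈ t.region := by rwa [t.region_eq, hk, hf]
      obtain h | h | ⟨e, he, h⟩ := t.mem_region_cases hzt
      · exact interior_mono (hmem t ht) h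
      · exact (hz (Set.mem_iUnion.2 ⟨p, h⟩)).elim
      · obtain ⟨s, hs, ha⟩ := hP.exists_across ht he
        exact mem_interior_iff_mem_nhds.2 (Filter.mem_of_superset (ha.union_mem_nhds he h)
          (Set.union_subset (hmem t ht) (hmem s hs)))
    · exact .inr hzU
  have hd : Dense Vᶜ := hVc.dense_compl ℝ
  have hconn : IsPreconnected Vᶜ :=
    (hVc.isConnected_compl_of_one_lt_rank (by rw [Complex.rank_real_complex]; norm_num)).2
  have hint : (Vᶜ ∩ interior U).Nonempty := by
    obtain ⟨k, F, h⟩ := hne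
    rw [Set.inter_comm]
    refine hd.inter_open_nonempty _ isOpen_interior ⟨centroid k F, ?_⟩
    refine mem_interior.2 ⟨cell k F, ?_, (hP.valid h).isOpen_cell, centroid_mem_cell⟩
    exact cell_subset_region.trans (Set.subset_iUnion
      (fun p : {p : RobinsonKind × Frame // P p.1 p.2} => region p.1.1 p.1.2) ⟨(k, F), h⟩)
  have hsub : Vᶜ ⊆ interior U := hconn.subset_left_of_subset_union isOpen_interior
    hUc.isOpen_compl (disjoint_compl_right.mono_left interior_subset) hcov hint
  rw [← hUc.closure_eq]
  exact (hd.mono (hsub.trans interior_subset)).closure_eq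

/-- The tiles of a nonempty tile system form a Penrose tiling. -/
theorem isPenroseTiling (hP : TileSystem P) (hne : ∃ k F, P k F) :
    IsPenroseTiling {t : RobinsonTriangle | P t.kind t.frame} where
  tiling := by
    refine ⟨fun t => ⟨?_, ?_⟩, fun s t h => ?_, ?_⟩
    · change IsClosed t.1.region
      rw [t.1.region_eq]
      exact t.1.frame_valid.isClosed_region
    · change (interior t.1.region).Nonempty
      rw [t.1.interior_region]
      exact ⟨_, centroid_mem_cell⟩
    · rw [← Set.not_nonempty_iff_eq_empty]
      exact fun h' => h (Subtype.ext (hP.eq_of_interior_inter s.2 t.2 h'))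
    · rw [← hP.iUnion_region hne]
      apply subset_antisymm
      · refine Set.iUnion_subset fun t => ?_
        rw [t.1.region_eq]
        exact Set.subset_iUnion (fun p : {p : RobinsonKind × Frame // P p.1 p.2} =>
          region p.1.1 p.1.2) ⟨(t.1.kind, t.1.frame), t.2⟩
      · refine Set.iUnion_subset fun p => ?_
        have hv := hP.valid p.2
        rw [← RobinsonTriangle.region_ofFrame hv]
        refine Set.subset_iUnion (fun t : {t : RobinsonTriangle | P t.kind t.frame} =>
          t.1.region) ⟨RobinsonTriangle.ofFrame p.1.1 p.1.2 hv, ?_⟩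
        rw [Set.mem_ofPred_eq, RobinsonTriangle.kind_ofFrame, RobinsonTriangle.frame_ofFrame]
        exact p.2
  edge_to_edge := fun _ hs _ ht hne => hP.edge_to_edge hs ht hne
  arrows_match := by
    intro s hs t ht hne e he f hf hef
    have hz : midpoint ℝ e.tail e.head ∈ openSegment ℝ e.tail e.head :=
      midpoint_mem_openSegment _ _
    have hzf : midpoint ℝ e.tail e.head ∈ f.seg := hef ▸ openSegment_subset_segment _ _ _ hz
    have ha := (hP.across_of_mem_openSegment hs ht he hz
      (t.seg_subset_region hf hzf)).resolve_left hne.symm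
    exact (t.eq_of_mem_openSegment ha.1 hf hz hzf).symm

end TileSystem

theorem mainTheorem4 :
    (∃ T : Set RobinsonTriangle, IsPenroseTiling T ∧ ∀ k : RobinsonKind, ∃ t ∈ T, t.kind = k) ∧
    (∀ T : Set RobinsonTriangle, IsPenroseTiling T →
      ¬ IsPeriodicFamily (fun t : T => t.1.region)) := by
  have hP := tileSystem_limitPatch
  have hne : ∃ k F, limitPatch k F := ⟨_, _, limitPatch_seed⟩
  refine ⟨⟨_, hP.isPenroseTiling hne, fun k => ?_⟩, fun T hT => hT.not_isPeriodicFamily⟩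
  have h : ∃ F, limitPatch k F := by
    cases k
    · exact ⟨_, limitPatch_seed⟩
    · exact hP.exists_halfDart hne
  obtain ⟨F, h⟩ := h
  refine ⟨RobinsonTriangle.ofFrame k F (hP.valid h), ?_, RobinsonTriangle.kind_ofFrame _⟩
  rwa [Set.mem_ofPred_eq, RobinsonTriangle.kind_ofFrame, RobinsonTriangle.frame_ofFrame]
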